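/- Let $p$ be a prime, let $\Gamma$ be a profinite group and let $\chi:\Gamma\to\mathbb{Z}_p^\times$ be a continuous character; write $\mathbb{Z}_p(1)$ for $\mathbb{Z}_p$ with $\Gamma$ acting through $\chi$. For a $\mathbb{Z}/p^r$-module $M$ with $\Gamma$-action and $i\in\mathbb{Z}$, let $M(i)$ be its twist by $\chi^i$ mod $p^r$. Assume that $\Gamma$ is $p$-manageable with respect to $\mathbb{Z}_p(1)$, that is: (a) $\Gamma$ has a pro-$p$-Sylow subgroup $\Gamma_p$ such that $H^2(\Gamma_p,\mathbb{F}_p)$ is one-dimensional over $\mathbb{F}_p$ and the cup-product pairing $H^1(\Gamma_p,\mathbb{F}_p)\times H^1(\Gamma_p,\mathbb{F}_p)\to H^2(\Gamma_p,\mathbb{F}_p)$ has trivial left kernel (no finite generation is assumed); (b) for a pro-$p$-Sylow subgroup $\Gamma_p\subset\Gamma$, the reduction map $H^1(\Gamma_p,(\mathbb{Z}/p^r)(1))\to H^1(\Gamma_p,\mathbb{F}_p(1))$ is surjective for every $r\ge 2$. (Cohomology is continuous cohomology with discrete coefficients.) No assumption on roots of unity, i.e. on the triviality of $\chi$ mod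 a power of $p$, is made. A complete $(\Gamma,r)$-flag of rank $d$, $\nabla_{d,r}=(V_{i,r})_{1\le i\le d}$, is a free $\mathbb{Z}/p^r$-module $V_{d,r}$ of rank $d$ with a continuous $\Gamma$-action (one that factors through the quotient by an open normal subgroup), together with $\Gamma$-stable submodules $0=V_{0,r}\subset V_{1,r}\subset\dots\subset V_{d,r}$ such that $V_{i,r}$ is free of rank $i$. Put $L_{i,r}=V_{i,r}/V_{i-1,r}$. The truncation $\nabla_{d-1,r}$ is the flag $0\subset V_{1,r}\subset\dots\subset V_{d-1,r}$, of rank $d-1$. For $1\le s\le r$, the reduction mod $p^s$ of $\nabla_{d,r}$ is the flag $\nabla_{d,s}$ with $V_{i,s}=V_{i,r}\otimes\mathbb{Z}/p^s$. Isomorphisms of flags are $\Gamma$-equivariant linear isomorphisms respecting the filtrations. The flag $\nabla_{d,r}$ is wound if for all $1\le i\le d-1$ the extension of $\mathbb{F}_p[\Gamma]$-modules $0\to L_{i,1}\to V_{i+1,1}/V_{i-1,1}\to L_{i+1,1}\to 0$ does not split. A wound flag is a wound Kummer flag if there is $N\in\mathbb{Z}$ such that $L_{i,r}\simeq \mathbf{W}_r\bigl(L_{i,1}(i)\bigr)(N-i)$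 for all $i=1,\dots,d$; here, for a one-dimensional $\mathbb{F}_p$-representation $L$ of $\Gamma$ with character $\chi_L$, $\mathbf{W}_r(L)$ is $\mathbb{Z}/p^r$ with $\Gamma$ acting through the composite of $\chi_L$ with the Teichmüller section $\mathbb{F}_p^\times\to(\mathbb{Z}/p^r)^\times$. Proposition (step-by-step liftability of wound Kummer flags). Let $d,r\ge 1$ and let $\nabla_{d,r}$ be a wound Kummer $(\Gamma,r)$-flag of rank $d$. Let $\nabla^\flat_{d-1,r+1}$ be a wound Kummer $(\Gamma,r+1)$-flag of rank $d-1$, together with an isomorphism $\phi:\nabla_{d-1,r}\xrightarrow{\sim}\nabla^\flat_{d-1,r}$ from the truncation of $\nabla_{d,r}$ to the reduction mod $p^r$ of $\nabla^\flat_{d-1,r+1}$. Then there exist a wound Kummer $(\Gamma,r+1)$-flag $\nabla_{d,r+1}$ of rank $d$, an isomorphism $\psi$ from its reduction mod $p^r$ to $\nabla_{d,r}$, and an isomorphism $\theta:\nabla_{d-1,r+1}\xrightarrow{\sim}\nabla^\flat_{d-1,r+1}$ from its truncation, such that the reduction of $\theta$ mod $p^r$ equals $\phi$, when the reduction of $\nabla_{d-1,r+1}$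 mod $p^r$ is identified with $\nabla_{d-1,r}$ through $\psi$. -/

import Mathlib

open scoped TensorProduct

universe u v

noncomputable section

/-! ## Continuous cohomology with discrete coefficients, in degrees one and two -/

namespace ContCoh

variable {R : Type*} [CommRing R] {G : Type*} [Group G] [TopologicalSpace G]
  {M : Type*} [AddCommGroup M] [Module R M]

/-- Continuous functions from a space `X` to the discrete module `M`. -/
def continuousFunctions (R : Type*) [CommRing R] (X : Type*) [TopologicalSpace X]
    (M : Type*) [AddCommGroup M] [Module R M] : Submodule R (X → M) where
  carrier := {f | IsLocallyConstant f}
  add_mem' hf hg := IsLocallyConstant.add hf hg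
  zero_mem' := IsLocallyConstant.const 0
  smul_mem' c _ hf := hf.comp (fun m => c • m)

/-- The coboundary `m ↦ (g ↦ g m - m)`. -/
def d0 (ρ : Representation R G M) : M →ₗ[R] (G → M) where
  toFun m g := ρ g m - m
  map_add' m n := by ext g; simp only [map_add, Pi.add_apply]; abel
  map_smul' c m := by ext g; simp [smul_sub]

/-- The coboundary `f ↦ ((g, h) ↦ g f(h) - f(gh) + f(g))`. -/
def d1 (ρ : Representation R G M) : (G → M) →ₗ[R] (G × G → M) where
  toFun f x := ρ x.1 (f x.2) - f (x.1 * x.2) + f x.1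
  map_add' f f' := by ext x; simp only [map_add, Pi.add_apply]; abel
  map_smul' c f := by ext x; simp [smul_sub]

/-- The coboundary `f ↦ ((g, h, k) ↦ g f(h, k) - f(gh, k) + f(g, hk) - f(g, h))`. -/
def d2 (ρ : Representation R G M) : (G × G → M) →ₗ[R] (G × G × G → M) where
  toFun f x := ρ x.1 (f (x.2.1, x.2.2)) - f (x.1 * x.2.1, x.2.2)
    + f (x.1, x.2.1 * x.2.2) - f (x.1, x.2.1)
  map_add' f f' := by ext x; simp only [map_add, Pi.add_apply]; abel
  map_smul' c f := by ext x; simp [smul_sub]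

/-- Continuous 1-cocycles. -/
def Z1 (ρ : Representation R G M) : Submodule R (G → M) :=
  continuousFunctions R G M ⊓ LinearMap.ker (d1 ρ)

/-- 1-coboundaries. -/
def B1 (ρ : Representation R G M) : Submodule R (G → M) := LinearMap.range (d0 ρ)

/-- `H¹(G, M)`. -/
abbrev H1 (ρ : Representation R G M) : Type _ := Z1 ρ ⧸ (B1 ρ).submoduleOf (Z1 ρ)

/-- Continuous 2-cocycles. -/
def Z2 (ρ : Representation R G M) : Submodule R (G × G → M) :=
  continuousFunctions R (G × G) M ⊓ LinearMap.ker (d2 ρ)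

/-- Coboundaries of continuous 1-cochains. -/
def B2 (ρ : Representation R G M) : Submodule R (G × G → M) :=
  (continuousFunctions R G M).map (d1 ρ)

/-- `H²(G, M)`. -/
abbrev H2 (ρ : Representation R G M) : Type _ := Z2 ρ ⧸ (B2 ρ).submoduleOf (Z2 ρ)

section Functoriality

variable {R' : Type*} [CommRing R'] {σ : R →+* R'} {M' : Type*} [AddCommGroup M'] [Module R' M']
  {ρ : Representation R G M} {ρ' : Representation R' G M'}

/-- The map on 1-cocycles induced by an equivariant map of coefficients. -/
def Z1map (φ : M →ₛₗ[σ] M') (hφ : ∀ g m, φ (ρ g m) = ρ' g (φ m)) : Z1 ρ →ₛₗ[σ] Z1 ρ' where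
  toFun f := ⟨fun g => φ (f.1 g), by
    refine ⟨f.2.1.comp φ, ?_⟩
    ext x
    have h := congrFun (LinearMap.mem_ker.1 f.2.2) x
    have h' := congrArg φ h
    simpa [d1, hφ] using h'⟩
  map_add' f f' := by ext g; simp
  map_smul' c f := by ext g; simp

/-- The map `H¹(G, M) → H¹(G, M')` induced by an equivariant map of coefficients. -/
def H1map (φ : M →ₛₗ[σ] M') (hφ : ∀ g m, φ (ρ g m) = ρ' g (φ m)) : H1 ρ →ₛₗ[σ] H1 ρ' :=
  Submodule.mapQ _ _ (Z1map φ hφ) (by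
    rintro f ⟨m, hm⟩
    refine ⟨φ m, ?_⟩
    ext g
    have h := congrArg φ (congrFun hm g)
    simpa [d0, hφ, Z1map] using h)

end Functoriality

section CupProduct

/-- The trivial module `k`. -/
abbrev triv (k : Type*) [CommRing k] (G : Type*) [Group G] : Representation k G k :=
  Representation.trivial k G k

variable {k : Type*} [CommRing k]

/-- The cup product of two 1-cocycles with values in the trivial module `k`: it is
`(g, h) ↦ f(g) · f'(h)`. -/
def cupZ (f f' : Z1 (triv k G)) : Z2 (triv k G) :=
  ⟨fun x => f.1 x.1 * f'.1 x.2, by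
    refine ⟨?_, ?_⟩
    · exact (f.2.1.comp_continuous continuous_fst).mul (f'.2.1.comp_continuous continuous_snd)
    · ext ⟨a, b, c⟩
      have h := congrFun (LinearMap.mem_ker.1 f.2.2) (a, b)
      have h' := congrFun (LinearMap.mem_ker.1 f'.2.2) (b, c)
      simp only [d1, LinearMap.coe_mk, AddHom.coe_mk, Representation.trivial_apply,
        Pi.zero_apply] at h h'
      simp only [d2, LinearMap.coe_mk, AddHom.coe_mk, Representation.trivial_apply,
        Pi.zero_apply]
      linear_combination f'.1 c * h - f.1 a * h'⟩

/-- The cup product on cocycles, as a bilinear map to `H²`. -/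
def cupZH : Z1 (triv k G) →ₗ[k] Z1 (triv k G) →ₗ[k] H2 (triv k G) :=
  LinearMap.mk₂ k (fun f f' => Submodule.Quotient.mk (cupZ f f'))
    (fun f₁ f₂ f' => by
      rw [← Submodule.Quotient.mk_add]; congr 1; ext x; simp [cupZ, add_mul])
    (fun c f f' => by
      rw [← Submodule.Quotient.mk_smul]; congr 1; ext x; simp [cupZ, mul_assoc])
    (fun f f₁ f₂ => by
      rw [← Submodule.Quotient.mk_add]; congr 1; ext x; simp [cupZ, mul_add])
    (fun c f f' => by
      rw [← Submodule.Quotient.mk_smul]; congr 1; ext x; simp [cupZ, mul_left_comm])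

lemma eq_zero_of_mem_B1 {f : Z1 (triv k G)} (hf : f ∈ (B1 (triv k G)).submoduleOf (Z1 (triv k G))) :
    f = 0 := by
  obtain ⟨m, hm⟩ := hf
  ext g
  have h := congrFun hm g
  simp [d0] at h
  simpa using h.symm

/-- The cup product `H¹(G, k) × H¹(G, k) → H²(G, k)`, for the trivial module `k`. -/
def cup : H1 (triv k G) →ₗ[k] H1 (triv k G) →ₗ[k] H2 (triv k G) :=
  Submodule.liftQ _
    (LinearMap.flip (Submodule.liftQ _ (LinearMap.flip cupZH) (by
      intro f hf
      rw [eq_zero_of_mem_B1 hf]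
      simp)))
    (by
      intro f hf
      rw [eq_zero_of_mem_B1 hf]
      simp)

end CupProduct

end ContCoh

/-! ## `p`-manageable profinite groups -/

namespace WoundKummer

section Groups

variable (p : ℕ)

/-- A (profinite) group is pro-`p` if all its quotients by open normal subgroups are
`p`-groups. -/
def IsProP (G : Type*) [Group G] [TopologicalSpace G] : Prop :=
  ∀ U : OpenNormalSubgroup G, IsPGroup p (G ⧸ U.toSubgroup)

/-- A pro-`p`-Sylow subgroup of a profinite group `Γ`: a closed pro-`p` subgroup, whose index is
prime to `p` as a supernatural number. -/
structure IsProPSylow {Γ : Type*} [Group Γ] [TopologicalSpace Γ] (P : Subgroup Γ) : Prop where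
  isClosed : IsClosed (P : Set Γ)
  isProP : IsProP p P
  index : ∀ U : OpenNormalSubgroup Γ, ¬ p ∣ (P ⊔ U.toSubgroup).index

/-- The Demuškin condition for pro-`p`-groups, without any finite generation assumption. -/
structure IsDemushkin (G : Type*) [Group G] [TopologicalSpace G] [Fact p.Prime] : Prop where
  isProP : IsProP p G
  finrank_H2 : Module.finrank (ZMod p) (ContCoh.H2 (ContCoh.triv (ZMod p) G)) = 1
  leftKernel : LinearMap.ker (ContCoh.cup (k := ZMod p) (G := G)) = ⊥

/-- A profinite group is `p`-Demuškin if it has a Demuškin pro-`p`-Sylow subgroup. -/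
def IsPDemushkin (Γ : Type*) [Group Γ] [TopologicalSpace Γ] [Fact p.Prime] : Prop :=
  ∃ P : Subgroup Γ, IsProPSylow p P ∧ IsDemushkin p P

end Groups

section Twist

variable {R : Type*} [CommRing R] {Γ : Type*} [Group Γ] {V : Type*} [AddCommGroup V] [Module R V]

/-- The twist of a representation by a character: `g` acts by `c(g) ρ(g)`. -/
def twist (c : Γ →* Rˣ) (ρ : Representation R Γ V) : Representation R Γ V where
  toFun g := (c g : R) • ρ g
  map_one' := by simp
  map_mul' g h := by
    ext v
    simp [smul_smul, mul_comm]

/-- The representation of `Γ` on `R` through the character `c`. -/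
def ofCharacter (c : Γ →* Rˣ) : Representation R Γ R := twist c (Representation.trivial R Γ R)

/-- The character by which `Γ` acts on a free module of rank one: the endomorphism given by a
scalar `a` has determinant `a`. -/
def character (ρ : Representation R Γ V) : Γ →* Rˣ := (LinearMap.det.comp ρ).toHomUnits

end Twist

section Cyclotomic

variable {p : ℕ} [Fact p.Prime] {Γ : Type*} [Group Γ] [TopologicalSpace Γ]

/-- The reduction mod `p^r` of a continuous character `χ : Γ → ℤ_pˣ`. -/
def charMod (χ : Γ →ₜ* ℤ_[p]ˣ) (r : ℕ) : Γ →* (ZMod (p ^ r))ˣ :=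
  (Units.map (PadicInt.toZModPow r : ℤ_[p] →+* ZMod (p ^ r)).toMonoidHom).comp χ.toMonoidHom

/-- `M(i) = M ⊗ (ℤ/p^r)(i)`, for a module `M` over `ℤ/p^r` with an action of `Γ`; here
`ℤ_p(1)` is `ℤ_p` with action through `χ`. -/
def tate (χ : Γ →ₜ* ℤ_[p]ˣ) {r : ℕ} {V : Type*} [AddCommGroup V] [Module (ZMod (p ^ r)) V]
    (i : ℤ) (ρ : Representation (ZMod (p ^ r)) Γ V) : Representation (ZMod (p ^ r)) Γ V :=
  twist (charMod χ r ^ i) ρ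

/-- `(ℤ/p^r)(1)`. -/
def tateOne (χ : Γ →ₜ* ℤ_[p]ˣ) (r : ℕ) : Representation (ZMod (p ^ r)) Γ (ZMod (p ^ r)) :=
  ofCharacter (charMod χ r)

/-- The reduction `ℤ/p^r → ℤ/p`, for `1 ≤ r`. -/
def redOne (p : ℕ) {r : ℕ} (hr : 1 ≤ r) : ZMod (p ^ r) →+* ZMod (p ^ 1) :=
  ZMod.castHom (pow_dvd_pow p hr) (ZMod (p ^ 1))

lemma redOne_equivariant (χ : Γ →ₜ* ℤ_[p]ˣ) {r : ℕ} (hr : 1 ≤ r) (P : Subgroup Γ) (g : P)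
    (m : ZMod (p ^ r)) :
    (redOne p hr).toSemilinearMap ((tateOne χ r).comp P.subtype g m) =
      (tateOne χ 1).comp P.subtype g ((redOne p hr).toSemilinearMap m) := by
  have h : redOne p hr (PadicInt.toZModPow r (χ g : ℤ_[p])) =
      PadicInt.toZModPow 1 (χ g : ℤ_[p]) := PadicInt.cast_toZModPow 1 r hr (χ g : ℤ_[p])
  change redOne p hr (PadicInt.toZModPow r (χ g : ℤ_[p]) * m) =
    PadicInt.toZModPow 1 (χ g : ℤ_[p]) * redOne p hr m
  rw [map_mul, h]

/-- The reduction map `H¹(P, (ℤ/p^r)(1)) → H¹(P, 𝔽_p(1))`, for a subgroup `P` of `Γ`. -/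
def redH1 (χ : Γ →ₜ* ℤ_[p]ˣ) {r : ℕ} (hr : 1 ≤ r) (P : Subgroup Γ) :
    ContCoh.H1 ((tateOne χ r).comp P.subtype) →ₛₗ[redOne p hr]
      ContCoh.H1 ((tateOne χ 1).comp P.subtype) :=
  ContCoh.H1map (redOne p hr).toSemilinearMap (redOne_equivariant χ hr P)

/-- The weak Hilbert 90 property of the pair `(Γ, ℤ_p(1))`: for a pro-`p`-Sylow `Γ_p` of `Γ`,
the map `H¹(Γ_p, (ℤ/p^r)(1)) → H¹(Γ_p, 𝔽_p(1))` is onto for every `r ≥ 2`. -/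
def WH90 (χ : Γ →ₜ* ℤ_[p]ˣ) : Prop :=
  ∃ P : Subgroup Γ, IsProPSylow p P ∧
    ∀ (r : ℕ) (hr : 2 ≤ r), Function.Surjective (redH1 χ (one_le_two.trans hr) P)

/-- `Γ` is `p`-manageable with respect to `ℤ_p(1)`, the module `ℤ_p` with action through `χ`. -/
structure IsManageable (χ : Γ →ₜ* ℤ_[p]ˣ) : Prop where
  isPDemushkin : IsPDemushkin p Γ
  wH90 : WH90 χ

/-- The Teichmüller section `𝔽_pˣ → (ℤ/p^r)ˣ`, through `W_r(𝔽_p) = ℤ/p^r`. -/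
def teichmuller (p : ℕ) [Fact p.Prime] (r : ℕ) : (ZMod (p ^ 1))ˣ →* (ZMod (p ^ r))ˣ :=
  Units.map
    (((TruncatedWittVector.zmodEquivTrunc p r).symm.toRingHom.comp
        (WittVector.truncate (p := p) (R := ZMod p) r)).toMonoidHom.comp
      ((WittVector.teichmuller p).comp
        (ZMod.ringEquivCongr (pow_one p)).toRingHom.toMonoidHom))

/-- The Teichmüller lift `W_r(L)` of a one-dimensional representation `L` over `𝔽_p`. -/
def teichmullerLift (r : ℕ) {V : Type*} [AddCommGroup V] [Module (ZMod (p ^ 1)) V]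
    (ρ : Representation (ZMod (p ^ 1)) Γ V) : Representation (ZMod (p ^ r)) Γ (ZMod (p ^ r)) :=
  ofCharacter ((teichmuller p r).comp (character ρ))

end Cyclotomic

/-! ## Filtered representations and flags -/

/-- A module over `ℤ/n` with a continuous action of `Γ` (through the quotient by an open normal
subgroup), and an increasing filtration `fil 0 ≤ fil 1 ≤ ⋯` by `Γ`-stable submodules. -/
structure FilRep (Γ : Type u) [Group Γ] [TopologicalSpace Γ] (n : ℕ) where
  V : Type v
  [addCommGroup : AddCommGroup V]
  [module : Module (ZMod n) V]
  ρ : Representation (ZMod n) Γ V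
  continuous : ∃ U : OpenNormalSubgroup Γ, ∀ g ∈ U, ρ g = 1
  fil : ℕ → Submodule (ZMod n) V
  mono : Monotone fil
  stable : ∀ i g, fil i ≤ (fil i).comap (ρ g)

attribute [instance] FilRep.addCommGroup FilRep.module

namespace FilRep

variable {Γ : Type u} [Group Γ] [TopologicalSpace Γ] {n : ℕ}

/-- `F` is a complete flag `0 = V_0 ⊂ V_1 ⊂ ⋯ ⊂ V_d` of rank `d`: each `V_i = F.fil i`, `i ≤ d`, is
a free `ℤ/n`-module of rank `i`, and `V_d` is the whole module. -/
structure IsCompleteFlag (F : FilRep.{u, v} Γ n) (d : ℕ) : Prop where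
  zero : F.fil 0 = ⊥
  top : F.fil d = ⊤
  free : ∀ i ≤ d, Module.Free (ZMod n) (F.fil i)
  finite : ∀ i ≤ d, Module.Finite (ZMod n) (F.fil i)
  finrank : ∀ i ≤ d, Module.finrank (ZMod n) (F.fil i) = i

/-- The truncation at `d`: the module `V_d` with its filtration by the `V_i ⊂ V_d`. -/
def trunc (F : FilRep.{u, v} Γ n) (d : ℕ) : FilRep.{u, v} Γ n where
  V := F.fil d
  ρ := F.ρ.subrepresentation (F.fil d) (F.stable d)
  continuous := by
    obtain ⟨U, hU⟩ := F.continuous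
    refine ⟨U, fun g hg => ?_⟩
    ext v
    simp [hU g hg]
  fil i := (F.fil i).submoduleOf (F.fil d)
  mono i j h := Submodule.comap_mono (F.mono h)
  stable i g v hv := F.stable i g hv

/-- The reduction mod `m`: the module `V ⊗_ℤ ℤ/m`, filtered by the images of the
`V_i ⊗_ℤ ℤ/m`. -/
def reduce (F : FilRep.{u, v} Γ n) (m : ℕ) : FilRep.{u, v} Γ m where
  V := ZMod m ⊗[ℤ] F.V
  ρ :=
    { toFun := fun g => ((F.ρ g).restrictScalars ℤ).baseChange (ZMod m)
      map_one' := by ext; simp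
      map_mul' := fun g h => by ext; simp }
  continuous := by
    obtain ⟨U, hU⟩ := F.continuous
    refine ⟨U, fun g hg => ?_⟩
    ext v
    simp [hU g hg]
  fil i := ((F.fil i).restrictScalars ℤ).baseChange (ZMod m)
  mono i j h := Submodule.baseChange_mono _ (F.mono h)
  stable i g := by
    change _ ≤ Submodule.comap (((F.ρ g).restrictScalars ℤ).baseChange (ZMod m)) _
    conv_lhs => rw [Submodule.baseChange_eq_span]
    rw [Submodule.span_le]
    rintro _ ⟨v, hv, rfl⟩
    exact Submodule.tmul_mem_baseChange_of_mem (A := ZMod m) (p := (F.fil i).restrictScalars ℤ) 1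
      (F.stable i g hv)

/-- The subquotient `V_{k/j} = V_k / V_j`. -/
abbrev Subquot (F : FilRep.{u, v} Γ n) (k j : ℕ) : Type v :=
  F.fil k ⧸ (F.fil j).submoduleOf (F.fil k)

/-- The action of `Γ` on `V_{k/j}`. -/
def subquotρ (F : FilRep.{u, v} Γ n) (k j : ℕ) : Representation (ZMod n) Γ (F.Subquot k j) :=
  (F.ρ.subrepresentation (F.fil k) (F.stable k)).quotient _ (fun g _ hv => F.stable j g hv)

/-- The surjection `V_{k/i} → V_{k/j}`, for `i ≤ j`. -/
def subquotProj (F : FilRep.{u, v} Γ n) (k : ℕ) {i j : ℕ} (h : i ≤ j) :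
    F.Subquot k i →ₗ[ZMod n] F.Subquot k j :=
  Submodule.factor (Submodule.comap_mono (F.mono h))

/-- The extension `0 → V_{j/i} → V_{k/i} → V_{k/j} → 0` of modules with action of `Γ` splits. -/
def ExtensionSplits (F : FilRep.{u, v} Γ n) (k : ℕ) {i j : ℕ} (h : i ≤ j) : Prop :=
  ∃ s : (F.subquotρ k j).IntertwiningMap (F.subquotρ k i), ∀ x, F.subquotProj k h (s x) = x

/-- Isomorphisms of filtered representations. -/
structure Iso (F G : FilRep.{u, v} Γ n) where
  equiv : F.V ≃ₗ[ZMod n] G.V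
  equivariant : ∀ g v, equiv (F.ρ g v) = G.ρ g (equiv v)
  map_fil : ∀ i, (F.fil i).map equiv.toLinearMap = G.fil i

/-- The map between truncations at `d` induced by an isomorphism. -/
def Iso.truncMap {F G : FilRep.{u, v} Γ n} (e : Iso F G) (d : ℕ) :
    (F.trunc d).V →ₗ[ZMod n] (G.trunc d).V :=
  e.equiv.toLinearMap.restrict (p := F.fil d) (q := G.fil d)
    (fun _ hv => e.map_fil d ▸ Submodule.mem_map_of_mem hv)

/-- The map between reductions mod `m` induced by an isomorphism. -/
def Iso.reduceMap {F G : FilRep.{u, v} Γ n} (e : Iso F G) (m : ℕ) :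
    (F.reduce m).V →ₗ[ZMod m] (G.reduce m).V :=
  (e.equiv.toLinearMap.restrictScalars ℤ).baseChange (ZMod m)

/-- The canonical map `V_d ⊗ ℤ/m → (V ⊗ ℤ/m)_d`, from the reduction of the truncation to the
truncation of the reduction. -/
def reduceTrunc (F : FilRep.{u, v} Γ n) (d m : ℕ) :
    ((F.trunc d).reduce m).V →ₗ[ZMod m] ((F.reduce m).trunc d).V :=
  LinearMap.codRestrict ((F.reduce m).fil d)
    (((F.fil d).subtype.restrictScalars ℤ).baseChange (ZMod m)) (by exact fun x => ⟨x, rfl⟩)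

end FilRep

section Kummer

variable {p : ℕ} [Fact p.Prime] {Γ : Type u} [Group Γ] [TopologicalSpace Γ] {r : ℕ}

/-- A flag of rank `d` is wound if none of the extensions
`0 → L_{i,1} → V_{i+1,1} / V_{i-1,1} → L_{i+1,1} → 0`, `1 ≤ i ≤ d - 1`, splits, where `V_{i,1}` is
the reduction of `V_i` mod `p`. -/
def IsWound (F : FilRep.{u, v} Γ (p ^ r)) (d : ℕ) : Prop :=
  ∀ i, 1 ≤ i → i + 1 ≤ d →
    ¬ (F.reduce (p ^ 1)).ExtensionSplits (i + 1) (i := i - 1) (j := i) (Nat.sub_le i 1)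

/-- A wound Kummer flag of rank `d`: a wound complete flag such that, for some integer `N`,
`L_i ≃ W_r(L_{i,1}(i))(N - i)` for all `1 ≤ i ≤ d`, where `L_i = V_i / V_{i-1}` and `L_{i,1}` is
its reduction mod `p`. -/
structure IsWoundKummer (χ : Γ →ₜ* ℤ_[p]ˣ) (F : FilRep.{u, v} Γ (p ^ r)) (d : ℕ) : Prop where
  isCompleteFlag : F.IsCompleteFlag d
  isWound : IsWound F d
  kummer : ∃ N : ℤ, ∀ i : ℕ, 1 ≤ i → i ≤ d →
    Nonempty ((F.subquotρ i (i - 1)).Equiv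
      (tate χ (N - i) (teichmullerLift r (tate χ i ((F.reduce (p ^ 1)).subquotρ i (i - 1))))))

end Kummer

end WoundKummer

end

/-! The flag of rank `d` is an extension of a line with character `μ_d`, generated by the image of
some `v`, by `V_{d-1}`. It is recorded by the cocycle `e(g) = μ_d(g)⁻¹ g v - v`, with values in
`V_{d-1}` twisted by `μ_d⁻¹`. The Kummer condition prescribes a lift `c` of `μ_d` mod `p^(r+1)`. So
the point is to lift `e`, as a cocycle and not only as a class, to `B` twisted by `c⁻¹`, where `B`
is the given lift of `V_{d-1}` (`exists_lift_of_isManageable`). The lifted cocycle defines an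
extension of `c` by `B` (`extension`), which is the wanted flag; it is wound because its reduction
mod `p` is that of the original flag.

The cocycle is lifted in two stages. Characters with values in `𝔽_pˣ` are trivial on pro-`p` groups,
so on a Sylow subgroup the twisted action on the last graded piece of `B` is through
`χ^((N-(d-1))-(N-d)) = χ`. Weak Hilbert 90 therefore lifts the image of `e` there
(`exists_lift_of_wH90`). A cochain lifting both `e` and this lift has its coboundary in `p^r
B_{d-2}`, a copy of `V_{d-2}` mod `p`.

The second stage uses that, for a wound flag over a Demuškin group, `H²(V_{i,1}) → H²(V_{i+1,1})` is
zero (`exists_cochain_of_wound`). Indeed the extension of consecutive lines has a nonzero class `a`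
in `H¹(𝔽_p)`, its connecting map is the cup product with `a`, and this is onto the one-dimensional
`H²`; so the component in the top line dies one step higher, and induction does the rest. The
cochain is thus corrected to a cocycle by a multiple of `p^r`, which does not change its reduction
(`exists_lift_of_isDemushkin`).

Corestriction, divided by an index prime to `p`, passes from a Sylow subgroup to `Γ`
(`exists_lift_of_sylow`). -/

noncomputable section

namespace ContCoh

/-! ### Cocycles and corestriction -/

section Cocycles

variable {R : Type*} [CommRing R] {G : Type*} [Group G] {A : Type*} [AddCommGroup A] [Module R A]

/-- The cocycle relation for a function on the group. -/
def IsCocycle (ρ : Representation R G A) (f : G → A) : Prop :=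
  ∀ g h, f (g * h) = f g + ρ g (f h)

namespace IsCocycle

variable {ρ : Representation R G A} {f f' : G → A}

lemma map_one (hf : IsCocycle ρ f) : f 1 = 0 := by
  simpa using hf 1 1

lemma map_inv (hf : IsCocycle ρ f) (g : G) : ρ g (f g⁻¹) = -f g := by
  have h := hf g g⁻¹
  rw [mul_inv_cancel, hf.map_one] at h
  exact (neg_eq_of_add_eq_zero_right h.symm).symm

lemma comp {H : Type*} [Group H] (hf : IsCocycle ρ f) (φ : H →* G) :
    IsCocycle (ρ.comp φ) (f ∘ φ) := fun g h => by simp [hf _ _]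

lemma coboundary (ρ : Representation R G A) (m : A) : IsCocycle ρ (fun g => ρ g m - m) :=
  fun g h => by simp

lemma add (hf : IsCocycle ρ f) (hf' : IsCocycle ρ f') : IsCocycle ρ (f + f') := fun g h => by
  simp only [Pi.add_apply, hf g h, hf' g h, map_add]; abel

lemma sub (hf : IsCocycle ρ f) (hf' : IsCocycle ρ f') : IsCocycle ρ (f - f') := fun g h => by
  simp only [Pi.sub_apply, hf g h, hf' g h, map_sub]; abel

lemma nsmul (hf : IsCocycle ρ f) (n : ℕ) : IsCocycle ρ (n • f) := fun g h => by
  simp only [Pi.smul_apply, hf g h, map_nsmul, smul_add]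

lemma map {R' : Type*} [CommRing R'] {A' : Type*} [AddCommGroup A'] [Module R' A']
    {ρ' : Representation R' G A'} (hf : IsCocycle ρ f) (π : A →+ A')
    (hπ : ∀ g a, π (ρ g a) = ρ' g (π a)) : IsCocycle ρ' (π ∘ f) := fun g h => by
  simp [hf g h, hπ]

lemma mem_ker_d1_iff : f ∈ LinearMap.ker (d1 ρ) ↔ IsCocycle ρ f := by
  rw [LinearMap.mem_ker]
  constructor
  · intro h g k
    have := congrFun h (g, k)
    simp only [d1, LinearMap.coe_mk, AddHom.coe_mk, Pi.zero_apply] at this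
    rw [← sub_eq_zero, ← neg_eq_zero]
    rw [← this]; abel
  · intro h
    ext ⟨g, k⟩
    simp [d1, h g k]

end IsCocycle

variable (H : Subgroup G) (ρ : Representation R G A)

/-- The corestriction of a cocycle on `H`, extended arbitrarily to `G`. -/
def cores [Fintype (G ⧸ H)] (f : G → A) (g : G) : A :=
  ∑ x : G ⧸ H, ρ (g • x).out (f ((g • x).out⁻¹ * g * x.out))

variable {H} in
lemma out_inv_mul_mul_out_mem (g : G) (x : G ⧸ H) : (g • x).out⁻¹ * g * x.out ∈ H := by
  rw [mul_assoc, ← QuotientGroup.eq, QuotientGroup.out_eq']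
  conv_lhs => rw [← QuotientGroup.out_eq' x]
  rfl

variable {H ρ} [Fintype (G ⧸ H)] {f : G → A}

/-- The representatives of `x` and `g h x` are joined through that of `h x`, which splits each
summand in two; translation by `h` reindexes the first half. Only the values of `f` on `H` enter. -/
lemma isCocycle_cores (hf : ∀ g ∈ H, ∀ h ∈ H, f (g * h) = f g + ρ g (f h)) :
    IsCocycle ρ (cores H ρ f) := fun g h => by
  have key : ∀ x : G ⧸ H, ρ ((g * h) • x).out (f (((g * h) • x).out⁻¹ * (g * h) * x.out)) =
      ρ (g • (h • x)).out (f ((g • (h • x)).out⁻¹ * g * (h • x).out)) +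
      ρ g (ρ (h • x).out (f ((h • x).out⁻¹ * h * x.out))) := fun x => by
    have e : ((g * h) • x).out⁻¹ * (g * h) * x.out =
        ((g • (h • x)).out⁻¹ * g * (h • x).out) * ((h • x).out⁻¹ * h * x.out) := by
      rw [mul_smul]; group
    rw [e, hf _ (out_inv_mul_mul_out_mem _ _) _ (out_inv_mul_mul_out_mem _ _), map_add, mul_smul]
    congr 1
    simp only [← Module.End.mul_apply, ← map_mul]
    congr 2
    group
  simp only [cores]
  rw [Finset.sum_congr rfl fun x _ => key x, Finset.sum_add_distrib, map_sum]
  congr 1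
  exact Equiv.sum_comp (MulAction.toPerm h)
    (fun x : G ⧸ H => ρ (g • x).out (f ((g • x).out⁻¹ * g * x.out)))

lemma cores_eq_zero {U : Subgroup G} [U.Normal] (hUH : U ≤ H) (hf : ∀ u ∈ U, f u = 0)
    {u : G} (hu : u ∈ U) : cores H ρ f u = 0 := by
  refine Finset.sum_eq_zero fun x _ => ?_
  have hx : u • x = x := by
    conv_lhs => rw [← QuotientGroup.out_eq' x]
    conv_rhs => rw [← QuotientGroup.out_eq' x]
    refine (QuotientGroup.eq.2 (hUH ?_)).symm
    simpa [mul_assoc] using Subgroup.Normal.conj_mem ‹U.Normal› u hu (x.out)⁻¹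
  rw [hx, hf, map_zero]
  simpa using Subgroup.Normal.conj_mem ‹U.Normal› u hu (x.out)⁻¹

/-- Expanding each summand by the cocycle relation leaves one copy of `f g` per coset and a sum that
`g` permutes. The primitive is explicit so that a lift of it can be subtracted later. -/
lemma cores_restrict (hf : IsCocycle ρ f) (g : G) :
    cores H ρ f g = H.index • f g + (ρ g (∑ x : G ⧸ H, f x.out) - ∑ x : G ⧸ H, f x.out) := by
  have key : ∀ x : G ⧸ H, ρ (g • x).out (f ((g • x).out⁻¹ * g * x.out)) =
      f g + ρ g (f x.out) - f (g • x).out := fun x => by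
    rw [mul_assoc, hf, map_add, hf.map_inv, hf, ← Module.End.mul_apply, ← _root_.map_mul,
      mul_inv_cancel, _root_.map_one, Module.End.one_apply]
    abel
  simp only [cores]
  rw [Finset.sum_congr rfl fun x _ => key x, Finset.sum_sub_distrib, Finset.sum_add_distrib,
    map_sum, Finset.sum_const, Finset.card_univ, Subgroup.index, Nat.card_eq_fintype_card,
    ← Equiv.sum_comp (MulAction.toPerm g) (fun x : G ⧸ H => f x.out), add_sub_assoc]
  rfl

lemma map_cores {R' : Type*} [CommRing R'] {A' : Type*} [AddCommGroup A'] [Module R' A']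
    {ρ' : Representation R' G A'} (π : A →+ A') (hπ : ∀ g a, π (ρ g a) = ρ' g (π a))
    {e : G → A'} (he : ∀ h ∈ H, π (f h) = e h) (g : G) :
    π (cores H ρ f g) = cores H ρ' e g := by
  simp only [cores, map_sum, hπ]
  exact Finset.sum_congr rfl fun x _ => by rw [he _ (out_inv_mul_mul_out_mem _ _)]

end Cocycles

end ContCoh

namespace WoundKummer

open ContCoh

/-! ### Descent from a pro-`p`-Sylow subgroup -/

section Sylow

variable {p : ℕ} {Γ : Type*} [Group Γ] [TopologicalSpace Γ] {R : Type*} [CommRing R] {A : Type*}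
  [AddCommGroup A] [Module R A] {ρ : Representation R Γ A}

/-- A cocycle on `P` extends to the subgroup `P U`. -/
lemma exists_extension_sup {P : Subgroup Γ} {f : P → A} (hf : IsCocycle (ρ.comp P.subtype) f)
    (U : OpenNormalSubgroup Γ) (hU : ∀ g : P, (g : Γ) ∈ U → f g = 0) (hρ : ∀ u ∈ U, ρ u = 1) :
    ∃ f' : Γ → A, (∀ (g : P) (u : Γ), u ∈ U → f' (g * u) = f g) ∧
      ∀ g ∈ P ⊔ U.toSubgroup, ∀ h ∈ P ⊔ U.toSubgroup, f' (g * h) = f' g + ρ g (f' h) := by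
  classical
  have hmem : ∀ g : Γ, g ∈ P ⊔ U.toSubgroup → ∃ x : P, ∃ u ∈ U, g = x * u := fun g hg => by
    have h := Subgroup.mul_normal P U.toSubgroup ▸ (SetLike.mem_coe.2 hg)
    obtain ⟨x, hx, u, hu, rfl⟩ := h
    exact ⟨⟨x, hx⟩, u, hu, rfl⟩
  -- Any decomposition `g = x u` will do, because `f` vanishes on `P ∩ U`. Outside `P U` the value
  -- is irrelevant.
  let f' : Γ → A := fun g => if h : ∃ x : P, ∃ u ∈ U, g = x * u then f h.choose else 0
  have key : ∀ (g : P) (u : Γ), u ∈ U → f' (g * u) = f g := fun g u hu => by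
    have h : ∃ x : P, ∃ u' ∈ U, (g : Γ) * u = x * u' := ⟨g, u, hu, rfl⟩
    simp only [f', dif_pos h]
    obtain ⟨u', hu', e⟩ := h.choose_spec
    set x := h.choose
    have hx : ((x⁻¹ * g : P) : Γ) ∈ U := by
      have : ((x⁻¹ * g : P) : Γ) = u' * u⁻¹ := by
        push_cast
        rw [eq_mul_inv_iff_mul_eq, mul_assoc, e]; group
      rw [this]
      exact mul_mem hu' (inv_mem hu)
    have := hf x (x⁻¹ * g)
    rw [hU _ hx, map_zero, add_zero, mul_inv_cancel_left] at this
    exact this.symm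
  refine ⟨f', key, fun g hg h hh => ?_⟩
  obtain ⟨x, u, hu, rfl⟩ := hmem g hg
  obtain ⟨y, w, hw, rfl⟩ := hmem h hh
  have e : (x : Γ) * u * (y * w) = ((x * y : P) : Γ) * ((y : Γ)⁻¹ * u * y * w) := by
    push_cast; group
  have hu' : (y : Γ)⁻¹ * u * y * w ∈ U := by
    refine mul_mem ?_ hw
    have := Subgroup.Normal.conj_mem U.isNormal' u hu (y : Γ)⁻¹
    rwa [inv_inv] at this
  rw [e, key _ _ hu', key _ _ hu, key _ _ hw, hf, map_mul, hρ u hu, mul_one]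
  rfl

variable [IsTopologicalGroup Γ]

lemma isLocallyConstant_of_openNormalSubgroup {X : Type*} {f : Γ → X} (U : OpenNormalSubgroup Γ)
    (hf : ∀ g, ∀ u ∈ U, f (g * u) = f g) : IsLocallyConstant f := by
  rw [IsLocallyConstant.iff_exists_open]
  intro g
  refine ⟨(g⁻¹ * ·) ⁻¹' (U : Set Γ), U.isOpen'.preimage (continuous_const_mul _), ?_,
    fun x hx => ?_⟩
  · simp [one_mem]
  · simpa using hf g _ hx

lemma isLocallyConstant_of_isCocycle {f : Γ → A} (hf : IsCocycle ρ f) (U : OpenNormalSubgroup Γ)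
    (hU : ∀ u ∈ U, f u = 0) : IsLocallyConstant f :=
  isLocallyConstant_of_openNormalSubgroup U fun g u hu => by simp [hf g u, hU u hu]

variable [CompactSpace Γ] [TotallyDisconnectedSpace Γ]

lemma exists_openNormalSubgroup_le {s : Set Γ} (hs : s ∈ nhds (1 : Γ)) :
    ∃ U : OpenNormalSubgroup Γ, ∀ u ∈ U, u ∈ s := by
  obtain ⟨t, hts, ht, h1⟩ := mem_nhds_iff.1 hs
  obtain ⟨U, hU⟩ := ProfiniteGrp.exist_openNormalSubgroup_sub_open_nhds_of_one ht h1
  exact ⟨U, fun u hu => hts (hU hu)⟩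

/-- A locally constant function on a subgroup is constant near `1`. -/
lemma exists_openNormalSubgroup_of_isLocallyConstant {P : Subgroup Γ} {X : Type*} {f : P → X}
    (hf : IsLocallyConstant f) : ∃ U : OpenNormalSubgroup Γ, ∀ g : P, (g : Γ) ∈ U → f g = f 1 := by
  obtain ⟨O, hO, hO'⟩ := isOpen_induced_iff.1 (hf.isOpen_fiber (f 1))
  have h1 : (1 : Γ) ∈ O := by
    have : (1 : P) ∈ Subtype.val ⁻¹' O := by rw [hO']; rfl
    exact this
  obtain ⟨U, hU⟩ := exists_openNormalSubgroup_le (hO.mem_nhds h1)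
  refine ⟨U, fun g hg => ?_⟩
  have : g ∈ Subtype.val ⁻¹' O := hU _ hg
  rwa [hO'] at this

/-- If the restriction of a cocycle to a pro-`p`-Sylow subgroup lifts along `π`, then its class
lifts. -/
theorem exists_lift_of_sylow [Fact p.Prime] {P : Subgroup Γ} (hP : IsProPSylow p P)
    {R' : Type*} [CommRing R'] {A' : Type*} [AddCommGroup A'] [Module R' A']
    {ρ' : Representation R' Γ A'} {s : ℕ} (hA' : ∀ a : A', p ^ s • a = 0)
    (hρ : ∃ U : OpenNormalSubgroup Γ, ∀ u ∈ U, ρ u = 1)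
    (π : A →+ A') (hπ : ∀ g a, π (ρ g a) = ρ' g (π a))
    {e : Γ → A'} (he : IsCocycle ρ' e) (he' : ∃ U : OpenNormalSubgroup Γ, ∀ u ∈ U, e u = 0)
    {f : P → A} (hf : IsCocycle (ρ.comp P.subtype) f) (hf' : IsLocallyConstant f)
    (hfe : ∀ g : P, π (f g) = e g) :
    ∃ (F : Γ → A) (t : A'), IsCocycle ρ F ∧ (∃ U : OpenNormalSubgroup Γ, ∀ u ∈ U, F u = 0) ∧
      ∀ g, π (F g) = e g + (ρ' g t - t) := by
  classical
  obtain ⟨U₁, h₁⟩ := hρ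
  obtain ⟨U₂, h₂⟩ := he'
  obtain ⟨U₃, h₃⟩ := exists_openNormalSubgroup_of_isLocallyConstant hf'
  let U := U₁ ⊓ U₂ ⊓ U₃
  have hU₁ : ∀ u ∈ U, ρ u = 1 := fun u hu => h₁ u hu.1.1
  have hU₂ : ∀ u ∈ U, e u = 0 := fun u hu => h₂ u hu.1.2
  have hU₃ : ∀ g : P, (g : Γ) ∈ U → f g = 0 := fun g hg => by rw [h₃ g hg.2, hf.map_one]
  obtain ⟨f', hf'1, hf'2⟩ := exists_extension_sup hf U hU₃ hU₁
  set H := P ⊔ U.toSubgroup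
  have hH : ¬ p ∣ H.index := hP.index U
  have : Fintype (Γ ⧸ H) :=
    Subgroup.fintypeOfIndexNeZero (fun h => hH (h ▸ dvd_zero p))
  have hc := isCocycle_cores hf'2
  have hmem : ∀ g : Γ, g ∈ H → ∃ x : P, ∃ u ∈ U, g = x * u := fun g hg => by
    have h := Subgroup.mul_normal P U.toSubgroup ▸ (SetLike.mem_coe.2 hg)
    obtain ⟨x, hx, u, hu, rfl⟩ := h
    exact ⟨⟨x, hx⟩, u, hu, rfl⟩
  have hm := map_cores (H := H) (f := f') π hπ (e := e) (fun h hh => by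
    obtain ⟨x, u, hu, rfl⟩ := hmem h hh
    rw [hf'1 x u hu, hfe, he, hU₂ u hu, map_zero, add_zero])
  have hcop : Nat.Coprime H.index (p ^ s) :=
    (Nat.Coprime.pow_left s ((Nat.Prime.coprime_iff_not_dvd Fact.out).2 hH)).symm
  -- `m` inverts the index mod `p^s`. The inversion is needed on `A'` only, so no torsion condition
  -- is put on `A`.
  obtain ⟨m, hm'⟩ := Nat.exists_mul_mod_eq_of_coprime 1 hcop
    (pow_ne_zero s (Fact.out : p.Prime).ne_zero)
  have hinv : ∀ a : A', m • H.index • a = a := fun a => by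
    have h1 : ∀ k : ℕ, k • a = (k % p ^ s) • a := fun k => by
      conv_lhs => rw [← Nat.mod_add_div k (p ^ s), add_smul, mul_smul, hA', add_zero]
    rw [smul_smul, mul_comm, h1, hm'.2, ← h1, one_smul]
  refine ⟨m • cores H ρ f', m • ∑ x : Γ ⧸ H, e x.out, hc.nsmul m, ⟨U, fun u hu => ?_⟩, fun g => ?_⟩
  · have : cores H ρ f' u = 0 := by
      have := U.isNormal'
      refine cores_eq_zero (U := U.toSubgroup) le_sup_right (fun u hu => ?_) hu
      have h := hf'1 1 u hu
      rwa [hf.map_one, OneMemClass.coe_one, one_mul] at h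
    simp [this]
  · rw [Pi.smul_apply, map_nsmul, hm, cores_restrict he, smul_add, hinv, smul_sub, map_nsmul]

/-- A cocycle on `Γ` which vanishes on a pro-`p`-Sylow subgroup is a coboundary. -/
theorem exists_coboundary_of_sylow [Fact p.Prime] {P : Subgroup Γ} (hP : IsProPSylow p P)
    {s : ℕ} (hA : ∀ a : A, p ^ s • a = 0)
    {e : Γ → A} (he : IsCocycle ρ e) (he' : ∃ U : OpenNormalSubgroup Γ, ∀ u ∈ U, e u = 0)
    (hP' : ∀ g : P, e g = 0) : ∃ t : A, ∀ g, e g = ρ g t - t := by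
  -- This is lifting along `0 → A`: the lift must vanish, and its comparison with `e` exhibits `e`
  -- as a coboundary.
  obtain ⟨F, t, -, -, h⟩ := exists_lift_of_sylow (R := ℤ) (A := PUnit.{1}) (ρ := 1) hP hA
    (he'.imp fun _ _ _ _ => rfl) (0 : PUnit.{1} →+ A) (fun _ _ => by simp) he he' (f := 0)
    (fun _ _ => rfl) (IsLocallyConstant.const _) (fun g => by simp [hP'])
  refine ⟨-t, fun g => ?_⟩
  have := h g
  simp only [AddMonoidHom.zero_apply] at this
  rw [map_neg, ← sub_eq_zero, this]; abel

/-- If the restriction of a cocycle to a pro-`p`-Sylow subgroup lifts along a surjection, then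
it lifts. -/
theorem exists_lift_of_sylow_of_surjective [Fact p.Prime] {P : Subgroup Γ} (hP : IsProPSylow p P)
    {R' : Type*} [CommRing R'] {A' : Type*} [AddCommGroup A'] [Module R' A']
    {ρ' : Representation R' Γ A'} {s : ℕ} (hA' : ∀ a : A', p ^ s • a = 0)
    (hρ : ∃ U : OpenNormalSubgroup Γ, ∀ u ∈ U, ρ u = 1)
    (π : A →+ A') (hπ : ∀ g a, π (ρ g a) = ρ' g (π a)) (hsurj : Function.Surjective π)
    {e : Γ → A'} (he : IsCocycle ρ' e) (he' : ∃ U : OpenNormalSubgroup Γ, ∀ u ∈ U, e u = 0)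
    {f : P → A} (hf : IsCocycle (ρ.comp P.subtype) f) (hf' : IsLocallyConstant f)
    (hfe : ∀ g : P, π (f g) = e g) :
    ∃ F : Γ → A, IsCocycle ρ F ∧ (∃ U : OpenNormalSubgroup Γ, ∀ u ∈ U, F u = 0) ∧
      ∀ g, π (F g) = e g := by
  obtain ⟨F, t, h1, ⟨U, hU⟩, h3⟩ := exists_lift_of_sylow hP hA' hρ π hπ he he' hf hf' hfe
  obtain ⟨V, hV⟩ := hρ
  obtain ⟨t, rfl⟩ := hsurj t
  refine ⟨F - fun g => ρ g t - t, h1.sub (IsCocycle.coboundary ρ t), ⟨U ⊓ V, fun u hu => ?_⟩,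
    fun g => ?_⟩
  · simp [hU u hu.1, hV u hu.2]
  · simp [h3, hπ]

end Sylow

/-! ### Characters mod `p^s` and their restriction to pro-`p` subgroups -/

section Characters

variable {p : ℕ} [Fact p.Prime]

/-- The reduction of units. -/
abbrev redUnits {n m : ℕ} (h : m ∣ n) : (ZMod n)ˣ →* (ZMod m)ˣ :=
  Units.map (ZMod.castHom h (ZMod m)).toMonoidHom

lemma redUnits_charMod {Γ : Type*} [Group Γ] [TopologicalSpace Γ] (χ : Γ →ₜ* ℤ_[p]ˣ) {s t : ℕ}
    (h : t ≤ s) (g : Γ) : redUnits (pow_dvd_pow p h) (charMod χ s g) = charMod χ t g :=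
  Units.ext (PadicInt.cast_toZModPow t s h (χ g : ℤ_[p]))

lemma redUnits_teichmuller {s t : ℕ} (h : t ≤ s) (x : (ZMod (p ^ 1))ˣ) :
    redUnits (pow_dvd_pow p h) (teichmuller p s x) = teichmuller p t x := by
  refine Units.ext ?_
  exact (TruncatedWittVector.commutes_symm' p t h _).symm.trans (by
    rw [TruncatedWittVector.truncate_wittVector_truncate]; rfl)

lemma redUnits_redUnits {n m k : ℕ} (h : m ∣ n) (h' : k ∣ m) (x : (ZMod n)ˣ) :
    redUnits h' (redUnits h x) = redUnits (h'.trans h) x :=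
  Units.ext (RingHom.congr_fun (Subsingleton.elim
    ((ZMod.castHom h' (ZMod k)).comp (ZMod.castHom h (ZMod m))) (ZMod.castHom (h'.trans h) _)) _)

variable {Γ : Type*} [Group Γ] [TopologicalSpace Γ]

lemma exists_openNormalSubgroup_charMod [IsTopologicalGroup Γ] [CompactSpace Γ]
    [TotallyDisconnectedSpace Γ] (χ : Γ →ₜ* ℤ_[p]ˣ) (s : ℕ) :
    ∃ U : OpenNormalSubgroup Γ, ∀ u ∈ U, charMod χ s u = 1 := by
  have hc : Continuous fun g : Γ => (χ g : ℤ_[p]) := Units.continuous_val.comp χ.continuous_toFun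
  -- On this set `χ` is `1` mod `p^s`, since a `p`-adic norm below `p^(1-s)` is at most `p^(-s)`.
  have hs : {g : Γ | dist (χ g : ℤ_[p]) 1 < (p : ℝ) ^ (-s + 1 : ℤ)} ∈ nhds (1 : Γ) := by
    refine (isOpen_lt (hc.dist continuous_const) continuous_const).mem_nhds ?_
    have : (0 : ℝ) < p := by exact_mod_cast (Fact.out : p.Prime).pos
    simp only [Set.mem_ofPred_eq, map_one, Units.val_one, dist_self]
    positivity
  obtain ⟨U, hU⟩ := exists_openNormalSubgroup_le hs
  refine ⟨U, fun u hu => Units.ext ?_⟩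
  have h := hU u hu
  rw [Set.mem_ofPred_eq, dist_eq_norm, ← PadicInt.norm_le_pow_iff_norm_lt_pow_add_one,
    PadicInt.norm_le_pow_iff_mem_span_pow, ← PadicInt.ker_toZModPow, RingHom.mem_ker, map_sub,
    map_one, sub_eq_zero] at h
  exact h

/-- `𝔽_pˣ` has no `p`-power torsion. This removes every Teichmüller part, and every twist mod `p`,
over a pro-`p` subgroup. -/
lemma eq_one_of_isProP {P : Subgroup Γ} (hP : IsProP p P) {α : Γ →* (ZMod (p ^ 1))ˣ}
    (hα : ∃ U : OpenNormalSubgroup Γ, ∀ u ∈ U, α u = 1) {g : Γ} (hg : g ∈ P) : α g = 1 := by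
  obtain ⟨U, hU⟩ := hα
  let U' : OpenNormalSubgroup P :=
    { toSubgroup := U.toSubgroup.subgroupOf P
      isOpen' := U.isOpen'.preimage continuous_subtype_val
      isNormal' := by have := U.isNormal'; infer_instance }
  obtain ⟨k, hk⟩ := hP U' (QuotientGroup.mk ⟨g, hg⟩)
  have h1 : α g ^ p ^ k = 1 := by
    rw [← map_pow]
    refine hU _ ?_
    rw [← QuotientGroup.mk_pow, QuotientGroup.eq_one_iff] at hk
    exact hk
  -- The `p^k`-th power is the identity on `𝔽_p`; the variable `q` stands for the exponent
  -- expression `p ^ 1`.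
  have h2 : ∀ q : ℕ, q = p → ∀ x : (ZMod q)ˣ, x ^ p ^ k = x := by
    rintro q rfl x
    exact Units.ext (by rw [Units.val_pow_eq_pow_val, ZMod.pow_card_pow])
  rwa [h2 _ (pow_one p)] at h1

end Characters

section Twist

variable {R : Type*} [CommRing R] {Γ : Type*} [Group Γ] {V : Type*} [AddCommGroup V] [Module R V]

@[simp]
lemma twist_apply (c : Γ →* Rˣ) (ρ : Representation R Γ V) (g : Γ) (v : V) :
    twist c ρ g v = (c g : R) • ρ g v := rfl

@[simp]
lemma ofCharacter_apply (c : Γ →* Rˣ) (g : Γ) (x : R) : ofCharacter c g x = c g * x := rfl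

lemma character_eq {ρ : Representation R Γ V} (e : V ≃ₗ[R] R) {c : Γ →* Rˣ}
    (h : ∀ g v, e (ρ g v) = c g * e v) : character ρ = c := by
  ext g
  change LinearMap.det (ρ g) = c g
  rw [← LinearMap.det_conj (ρ g) e, LinearMap.det_ring]
  simp [h]

lemma twist_ofCharacter (c c' : Γ →* Rˣ) : twist c (ofCharacter c') = ofCharacter (c * c') := by
  ext g
  simp

end Twist

/-! ### Reductions, graded lines and split extensions -/

namespace FilRep

section Reduce

variable {M : Type*} [AddCommGroup M] (m : ℕ)

lemma exists_eq_one_tmul (y : ZMod m ⊗[ℤ] M) : ∃ x : M, (1 : ZMod m) ⊗ₜ[ℤ] x = y := by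
  induction y with
  | zero => exact ⟨0, TensorProduct.tmul_zero _ _⟩
  | tmul a x =>
    obtain ⟨k, rfl⟩ := ZMod.intCast_surjective a
    exact ⟨k • x, by rw [← TensorProduct.smul_tmul, zsmul_one]⟩
  | add a b ha hb =>
    obtain ⟨x, rfl⟩ := ha
    obtain ⟨y, rfl⟩ := hb
    exact ⟨x + y, TensorProduct.tmul_add _ _ _⟩

lemma one_tmul_nsmul (x : M) : (1 : ZMod m) ⊗ₜ[ℤ] (m • x) = 0 := by
  rw [← natCast_zsmul, ← TensorProduct.smul_tmul]
  simp

variable {m} in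
lemma map_eq_zero_of_one_tmul_eq_zero {N : Type*} [AddCommGroup N] [Module (ZMod m) N] (f : M →+ N)
    {x : M} (h : (1 : ZMod m) ⊗ₜ[ℤ] x = 0) : f x = 0 := by
  have := congrArg (f.toIntLinearMap.liftBaseChange (ZMod m)) h
  rwa [LinearMap.liftBaseChange_tmul, map_zero, one_smul] at this

/-- A tensor that vanishes is tested on `M → M / m M`, whose target is a `ℤ/m`-module. -/
lemma one_tmul_eq_zero_iff (x : M) : (1 : ZMod m) ⊗ₜ[ℤ] x = 0 ↔ ∃ y, x = m • y := by
  constructor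
  · intro h
    let S : AddSubgroup M := (nsmulAddMonoidHom m : M →+ M).range
    let _ : Module (ZMod m) (M ⧸ S) := QuotientAddGroup.zmodModule fun x => ⟨x, rfl⟩
    obtain ⟨y, hy⟩ := (QuotientAddGroup.eq_zero_iff x).1
      (map_eq_zero_of_one_tmul_eq_zero (QuotientAddGroup.mk' S) h)
    exact ⟨y, hy.symm⟩
  · rintro ⟨y, rfl⟩
    exact one_tmul_nsmul m y

end Reduce

variable {Γ : Type u} [Group Γ] [TopologicalSpace Γ] {n : ℕ}

section

variable (F : FilRep.{u, v} Γ n) (m : ℕ)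

/-- The reduction map `V → V ⊗ ℤ/m`. -/
def toReduce : F.V →+ (F.reduce m).V :=
  (TensorProduct.mk ℤ (ZMod m) F.V 1).toAddMonoidHom

lemma toReduce_surjective : Function.Surjective (F.toReduce m) := exists_eq_one_tmul m

lemma toReduce_eq_zero_iff (x : F.V) : F.toReduce m x = 0 ↔ ∃ y, x = m • y :=
  one_tmul_eq_zero_iff m x

@[simp]
lemma reduce_ρ_toReduce (g : Γ) (x : F.V) :
    (F.reduce m).ρ g (F.toReduce m x) = F.toReduce m (F.ρ g x) :=
  LinearMap.baseChange_tmul _ _ _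

lemma toReduce_smul (h : m ∣ n) (a : ZMod n) (x : F.V) :
    F.toReduce m (a • x) = ZMod.castHom h (ZMod m) a • F.toReduce m x := by
  obtain ⟨k, rfl⟩ := ZMod.intCast_surjective a
  rw [Int.cast_smul_eq_zsmul, map_zsmul, map_intCast, Int.cast_smul_eq_zsmul]

lemma mem_reduce_fil_iff (i : ℕ) (y : (F.reduce m).V) :
    y ∈ (F.reduce m).fil i ↔ ∃ v ∈ F.fil i, F.toReduce m v = y := by
  constructor
  · rintro ⟨x, rfl⟩
    obtain ⟨⟨v, hv⟩, rfl⟩ := exists_eq_one_tmul m x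
    exact ⟨v, hv, rfl⟩
  · rintro ⟨v, hv, rfl⟩
    exact ⟨1 ⊗ₜ ⟨v, hv⟩, LinearMap.baseChange_tmul _ _ _⟩

end

/-- The graded piece `V_i / V_{i-1}` is a line on which `Γ` acts by `μ`; it is trivialized by a
linear form on the whole module, which takes the value `1` on `u ∈ V_i`. -/
structure IsLine (F : FilRep.{u, v} Γ n) (i : ℕ) (μ : Γ →* (ZMod n)ˣ) (l : F.V →ₗ[ZMod n] ZMod n)
    (u : F.V) : Prop where
  mem : u ∈ F.fil i
  apply_self : l u = 1
  eq_zero_iff : ∀ v ∈ F.fil i, l v = 0 ↔ v ∈ F.fil (i - 1)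
  apply_ρ : ∀ g, ∀ v ∈ F.fil i, l (F.ρ g v) = μ g * l v

variable {F : FilRep.{u, v} Γ n} {i : ℕ} {μ : Γ →* (ZMod n)ˣ} {l : F.V →ₗ[ZMod n] ZMod n} {u : F.V}

namespace IsLine

lemma sub_mem (h : F.IsLine i μ l u) {v : F.V} (hv : v ∈ F.fil i) :
    v - l v • u ∈ F.fil (i - 1) :=
  (h.eq_zero_iff _ (Submodule.sub_mem _ hv (Submodule.smul_mem _ _ h.mem))).1
    (by simp [h.apply_self])

/-- The linear form induced on the reduction. -/
def redForm (F : FilRep.{u, v} Γ n) {m : ℕ} (hm : m ∣ n) (l : F.V →ₗ[ZMod n] ZMod n) :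
    (F.reduce m).V →ₗ[ZMod m] ZMod m :=
  LinearMap.liftBaseChange (ZMod m)
    ((ZMod.castHom hm (ZMod m)).toAddMonoidHom.comp l.toAddMonoidHom).toIntLinearMap

@[simp]
lemma redForm_toReduce {m : ℕ} (hm : m ∣ n) (x : F.V) :
    redForm F hm l (F.toReduce m x) = ZMod.castHom hm (ZMod m) (l x) :=
  one_smul (ZMod m) (ZMod.castHom hm (ZMod m) (l x))

lemma exists_eq_mul_of_castHom_eq_zero {n m : ℕ} (hm : m ∣ n) {x : ZMod n}
    (hx : ZMod.castHom hm (ZMod m) x = 0) : ∃ t : ZMod n, x = m * t := by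
  obtain ⟨k, rfl⟩ := ZMod.intCast_surjective x
  rw [map_intCast, ZMod.intCast_zmod_eq_zero_iff_dvd] at hx
  obtain ⟨t, rfl⟩ := hx
  exact ⟨t, by push_cast; rfl⟩

lemma reduce (h : F.IsLine i μ l u) {m : ℕ} (hm : m ∣ n) :
    (F.reduce m).IsLine i ((redUnits hm).comp μ) (redForm F hm l) (F.toReduce m u) where
  mem := (mem_reduce_fil_iff F m i _).2 ⟨u, h.mem, rfl⟩
  apply_self := by rw [redForm_toReduce, h.apply_self, map_one]
  eq_zero_iff y hy := by
    obtain ⟨v, hv, rfl⟩ := (mem_reduce_fil_iff F m i y).1 hy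
    rw [redForm_toReduce, mem_reduce_fil_iff]
    constructor
    · intro h0
      obtain ⟨t, ht⟩ := exists_eq_mul_of_castHom_eq_zero hm h0
      -- Removing `l v • u` puts `v` in the smaller step and leaves its reduction unchanged, as `l
      -- v` is zero mod `m`.
      refine ⟨_, h.sub_mem hv, ?_⟩
      rw [map_sub, sub_eq_self, toReduce_smul _ _ hm, h0, zero_smul]
    · rintro ⟨w, hw, hwv⟩
      have : F.toReduce m (v - w) = 0 := by rw [map_sub, hwv, sub_self]
      obtain ⟨y, hy⟩ := (toReduce_eq_zero_iff F m _).1 this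
      have hw0 := (h.eq_zero_iff w (F.mono (Nat.sub_le i 1) hw)).2 hw
      rw [← sub_zero (l v), ← hw0, ← map_sub, hy, map_nsmul, map_nsmul, nsmul_eq_mul]
      simp
  apply_ρ g y hy := by
    obtain ⟨v, hv, rfl⟩ := (mem_reduce_fil_iff F m i y).1 hy
    rw [reduce_ρ_toReduce, redForm_toReduce, redForm_toReduce, h.apply_ρ g v hv, map_mul]
    rfl

/-- The trivialization of the graded piece. -/
def subquotEquiv (h : F.IsLine i μ l u) : F.Subquot i (i - 1) ≃ₗ[ZMod n] ZMod n :=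
  LinearEquiv.ofBijective (Submodule.liftQ _ (l.domRestrict (F.fil i)) (fun v hv =>
    (h.eq_zero_iff v v.2).2 hv)) ⟨by
      refine (injective_iff_map_eq_zero _).2 fun x hx => ?_
      obtain ⟨v, rfl⟩ := Submodule.Quotient.mk_surjective _ x
      exact (Submodule.Quotient.mk_eq_zero _).2 ((h.eq_zero_iff v v.2).1 hx),
    fun a => ⟨Submodule.Quotient.mk (a • ⟨u, h.mem⟩), by
      change l (a • u) = a
      rw [map_smul, h.apply_self, smul_eq_mul, mul_one]⟩⟩

lemma subquotEquiv_ρ (h : F.IsLine i μ l u) (g : Γ) (x : F.Subquot i (i - 1)) :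
    h.subquotEquiv (F.subquotρ i (i - 1) g x) = μ g * h.subquotEquiv x := by
  obtain ⟨v, rfl⟩ := Submodule.Quotient.mk_surjective _ x
  exact h.apply_ρ g v v.2

lemma character_twist_subquotρ (h : F.IsLine i μ l u) (c : Γ →* (ZMod n)ˣ) :
    character (twist c (F.subquotρ i (i - 1))) = c * μ :=
  character_eq h.subquotEquiv fun g v => by
    simp [h.subquotEquiv_ρ, mul_assoc]

lemma nonempty_equiv (h : F.IsLine i μ l u) :
    Nonempty ((F.subquotρ i (i - 1)).Equiv (ofCharacter μ)) :=
  ⟨Representation.Equiv.mk h.subquotEquiv fun g => LinearMap.ext fun x => h.subquotEquiv_ρ g x⟩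

end IsLine

/-- If all the graded pieces of a filtration are lines, its steps are direct factors. -/
lemma exists_retraction (F : FilRep.{u, v} Γ n) {d : ℕ} (hd : F.fil d = ⊤)
    (h : ∀ i, 1 ≤ i → i ≤ d → ∃ (l : F.fil i →ₗ[ZMod n] ZMod n) (u : F.fil i), l u = 1 ∧
      ∀ v, l v = 0 ↔ v.1 ∈ F.fil (i - 1)) {i : ℕ} (hi : i ≤ d) :
    ∃ f : F.V →ₗ[ZMod n] F.fil i, ∀ v : F.fil i, f v = v := by
  obtain ⟨k, rfl⟩ := Nat.exists_eq_add_of_le hi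
  clear hi
  induction k generalizing i with
  | zero =>
    refine ⟨LinearMap.codRestrict _ LinearMap.id fun v => ?_, fun v => rfl⟩
    rw [add_zero] at hd
    rw [hd]; trivial
  | succ k ih =>
    obtain ⟨f, hf⟩ := ih (i := i + 1) (by rwa [show i + 1 + k = i + (k + 1) by ring])
      (fun j h1 h2 => h j h1 (by omega))
    obtain ⟨l, u, hu, hl⟩ := h (i + 1) (by omega) (by omega)
    -- Retract onto the step `i + 1`, then project onto the step `i` along `u`.
    refine ⟨LinearMap.codRestrict _ ((F.fil (i + 1)).subtype ∘ₗ
      (f - LinearMap.toSpanSingleton _ _ u ∘ₗ l ∘ₗ f)) fun v => ?_, fun v => ?_⟩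
    · exact (hl ((f - LinearMap.toSpanSingleton _ _ u ∘ₗ l ∘ₗ f) v)).1 (by simp [hu])
    · have hv : (v : F.V) ∈ F.fil (i + 1) := F.mono (Nat.le_succ i) v.2
      have h1 : f v = ⟨v, hv⟩ := hf ⟨v, hv⟩
      have h2 : l ⟨v, hv⟩ = 0 := (hl ⟨v, hv⟩).2 v.2
      refine Subtype.ext ?_
      change ((f v - l (f v) • u : F.fil (i + 1)) : F.V) = v
      rw [h1, h2, zero_smul, sub_zero]

/-- The trivialization of the graded piece lives on the step `i`; a retraction extends it to a form
on the whole module. -/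
lemma exists_isLine (F : FilRep.{u, v} Γ n) {d : ℕ} (hd : F.fil d = ⊤) (μ : ℕ → Γ →* (ZMod n)ˣ)
    (h : ∀ i, 1 ≤ i → i ≤ d → Nonempty ((F.subquotρ i (i - 1)).Equiv (ofCharacter (μ i)))) {i : ℕ}
    (hi : 1 ≤ i) (hid : i ≤ d) : ∃ l u, F.IsLine i (μ i) l u := by
  have key : ∀ i, 1 ≤ i → i ≤ d → ∃ (l : F.fil i →ₗ[ZMod n] ZMod n) (u : F.fil i), l u = 1 ∧
      (∀ v, l v = 0 ↔ v.1 ∈ F.fil (i - 1)) ∧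
      ∀ g (v : F.fil i), l ⟨F.ρ g v, F.stable i g v.2⟩ = μ i g * l v := fun i hi hid => by
    obtain ⟨e⟩ := h i hi hid
    obtain ⟨u, hu⟩ := Submodule.Quotient.mk_surjective _ (e.toLinearEquiv.symm 1)
    refine ⟨e.toLinearEquiv.toLinearMap ∘ₗ Submodule.mkQ _, u, ?_, fun v => ?_, fun g v => ?_⟩
    · rw [LinearMap.comp_apply, Submodule.mkQ_apply, hu]
      exact e.toLinearEquiv.apply_symm_apply 1
    · exact (LinearEquiv.map_eq_zero_iff e.toLinearEquiv).trans (Submodule.Quotient.mk_eq_zero _)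
    · exact e.toIntertwiningMap.isIntertwining _ _ g (Submodule.Quotient.mk v)
  obtain ⟨f, hf⟩ := F.exists_retraction hd (fun i h1 h2 => by
    obtain ⟨l, u, hu, hl, -⟩ := key i h1 h2
    exact ⟨l, u, hu, hl⟩) hid
  obtain ⟨l, u, hu, hl, hρ⟩ := key i hi hid
  have hf' : ∀ v (hv : v ∈ F.fil i), f v = ⟨v, hv⟩ := fun v hv => hf ⟨v, hv⟩
  refine ⟨l ∘ₗ f, u, u.2, ?_, fun v hv => ?_, fun g v hv => ?_⟩
  · rw [LinearMap.comp_apply, hf, hu]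
  · rw [LinearMap.comp_apply, hf' v hv, hl]
  · rw [LinearMap.comp_apply, LinearMap.comp_apply, hf' v hv, hf' _ (F.stable i g hv), ← hρ]

/-- A vector of `V_{i+1}` which generates `V_{i+1} / V_i` and spans a stable line modulo
`V_{i-1}`. -/
def IsSplitVector (F : FilRep.{u, v} Γ n) (i : ℕ) (v : F.V) : Prop :=
  v ∈ F.fil (i + 1) ∧ (∀ w ∈ F.fil (i + 1), ∃ a : ZMod n, w - a • v ∈ F.fil i) ∧
    ∀ g, ∃ a : ZMod n, F.ρ g v - a • v ∈ F.fil (i - 1)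

/-- The vector is a representative of the image of the generator under the section. Unlike a
section, it is easily carried along a map of filtered modules. -/
lemma exists_isSplitVector_of_extensionSplits (h : F.IsLine (i + 1) μ l u)
    (hs : F.ExtensionSplits (i + 1) (i := i - 1) (j := i) (Nat.sub_le i 1)) :
    ∃ v, F.IsSplitVector i v := by
  obtain ⟨s, hs⟩ := hs
  let u' : F.fil (i + 1) := ⟨u, h.mem⟩
  obtain ⟨v, hv⟩ := Submodule.Quotient.mk_surjective _ (s (Submodule.Quotient.mk u'))
  have h1 : v.1 - u ∈ F.fil i := by
    have := hs (Submodule.Quotient.mk u')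
    rw [← hv] at this
    exact (Submodule.Quotient.eq ((F.fil i).submoduleOf (F.fil (i + 1)))).1 this
  have hlv : l v = 1 := by
    have := (h.eq_zero_iff _ (F.mono (Nat.le_succ i) h1)).2 h1
    rwa [map_sub, h.apply_self, sub_eq_zero] at this
  refine ⟨v, v.2, fun w hw => ⟨l w, ?_⟩, fun g => ⟨μ g, ?_⟩⟩
  · refine (h.eq_zero_iff _ (Submodule.sub_mem _ hw (Submodule.smul_mem _ _ v.2))).1 ?_
    rw [map_sub, map_smul, hlv, smul_eq_mul, mul_one, sub_self]
  · have h2 : F.subquotρ (i + 1) i g (Submodule.Quotient.mk u') =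
        (μ g : ZMod n) • Submodule.Quotient.mk u' := by
      refine (Submodule.Quotient.eq _).2 ((h.eq_zero_iff _ ?_).1 ?_)
      · exact Submodule.sub_mem _ (F.stable _ _ h.mem) (Submodule.smul_mem _ _ h.mem)
      · change l (F.ρ g u - (μ g : ZMod n) • u) = 0
        rw [map_sub, map_smul, h.apply_ρ g u h.mem, smul_eq_mul, sub_self]
    have h3 := congrArg s h2
    rw [s.isIntertwining, map_smul, ← hv] at h3
    exact (Submodule.Quotient.eq ((F.fil (i - 1)).submoduleOf (F.fil (i + 1)))).1 h3

/-- The vector is not normalized, but `l v` is a unit with inverse `b`, which forces the scalar by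
which `g` acts on it to be `μ g`; the section sends the generator to the class of `b • v`. -/
lemma IsSplitVector.extensionSplits (h : F.IsLine (i + 1) μ l u) {v : F.V}
    (hv : F.IsSplitVector i v) :
    F.ExtensionSplits (i + 1) (i := i - 1) (j := i) (Nat.sub_le i 1) := by
  obtain ⟨hv, hgen, hρ⟩ := hv
  obtain ⟨b, hb⟩ := hgen u h.mem
  have hb' : b * l v = 1 := by
    have := (h.eq_zero_iff _ (F.mono (Nat.le_succ i) hb)).2 hb
    rw [map_sub, h.apply_self, map_smul, smul_eq_mul, sub_eq_zero] at this
    exact this.symm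
  let v' : F.fil (i + 1) := ⟨b • v, Submodule.smul_mem _ _ hv⟩
  have hlv : l (b • v) = 1 := by rw [map_smul, smul_eq_mul, hb']
  have hμ : ∀ g, F.ρ g v - (μ g : ZMod n) • v ∈ F.fil (i - 1) := fun g => by
    obtain ⟨a, ha⟩ := hρ g
    have := F.mono (Nat.sub_le i 1) ha
    have := (h.eq_zero_iff _ (F.mono (Nat.le_succ i) this)).2 this
    rw [map_sub, map_smul, h.apply_ρ g v hv, smul_eq_mul, ← sub_mul] at this
    have : (μ g : ZMod n) - a = 0 := by
      rw [← mul_one ((μ g : ZMod n) - a), ← hb', mul_left_comm, this, mul_zero]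
    rwa [sub_eq_zero.1 this]
  refine ⟨LinearMap.intertwiningMap_of_isIntertwiningMap _ _
    (LinearMap.toSpanSingleton _ _ (Submodule.Quotient.mk v') ∘ₗ h.subquotEquiv.toLinearMap)
    fun g x => ?_, fun x => ?_⟩
  · obtain ⟨w, rfl⟩ := Submodule.Quotient.mk_surjective _ x
    have e1 : h.subquotEquiv (F.subquotρ (i + 1) i g (Submodule.Quotient.mk w)) = μ g * l w :=
      h.subquotEquiv_ρ g _
    change h.subquotEquiv (F.subquotρ (i + 1) i g (Submodule.Quotient.mk w)) •
      Submodule.Quotient.mk v' = F.subquotρ (i + 1) (i - 1) g (l w • Submodule.Quotient.mk v')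
    rw [e1, map_smul, mul_comm, mul_smul]
    congr 1
    refine ((Submodule.Quotient.eq _).2 ?_).symm
    have := Submodule.smul_mem _ b (hμ g)
    rw [smul_sub, ← map_smul, smul_comm] at this
    exact this
  · obtain ⟨w, rfl⟩ := Submodule.Quotient.mk_surjective _ x
    change F.subquotProj (i + 1) _ (l w • Submodule.Quotient.mk v') = _
    rw [map_smul]
    refine (Submodule.Quotient.eq _).2 ((h.eq_zero_iff _ ?_).1 ?_)
    · exact Submodule.sub_mem _ (Submodule.smul_mem _ _ v'.2) w.2
    · change l (l w • (b • v) - w) = 0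
      rw [map_sub, map_smul, hlv, smul_eq_mul, mul_one, sub_self]

end FilRep

/-! ### The Kummer condition as an identity between characters -/

section Kummer

variable {p : ℕ} [Fact p.Prime] {Γ : Type u} [Group Γ] [TopologicalSpace Γ] {s : ℕ}

/-- The character of `W_s(L(i))(N - i)`, where `L` is a line over `𝔽_p` with character `κ`. -/
def kummerChar (χ : Γ →ₜ* ℤ_[p]ˣ) (s : ℕ) (N : ℤ) (i : ℕ) (κ : Γ →* (ZMod (p ^ 1))ˣ) :
    Γ →* (ZMod (p ^ s))ˣ :=
  charMod χ s ^ (N - i) * (teichmuller p s).comp (charMod χ 1 ^ (i : ℤ) * κ)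

lemma redUnits_kummerChar (χ : Γ →ₜ* ℤ_[p]ˣ) {t : ℕ} (h : t ≤ s) (N : ℤ) (i : ℕ)
    (κ : Γ →* (ZMod (p ^ 1))ˣ) :
    (redUnits (pow_dvd_pow p h)).comp (kummerChar χ s N i κ) = kummerChar χ t N i κ := by
  refine MonoidHom.ext fun g => ?_
  change redUnits _ (charMod χ s g ^ (N - i) * teichmuller p s _) =
    charMod χ t g ^ (N - i) * teichmuller p t _
  rw [map_mul, map_zpow, redUnits_charMod χ h, redUnits_teichmuller h]

/-- The Kummer condition, in terms of characters. -/
lemma exists_isLine_of_kummer {χ : Γ →ₜ* ℤ_[p]ˣ} (hs : 1 ≤ s) {F : FilRep.{u, v} Γ (p ^ s)} {d : ℕ}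
    (hF : F.fil d = ⊤) {N : ℤ} (h : ∀ i : ℕ, 1 ≤ i → i ≤ d →
      Nonempty ((F.subquotρ i (i - 1)).Equiv
        (tate χ (N - i) (teichmullerLift s (tate χ i ((F.reduce (p ^ 1)).subquotρ i (i - 1)))))))
    {i : ℕ} (hi : 1 ≤ i) (hid : i ≤ d) :
    ∃ μ l u, F.IsLine i μ l u ∧
      μ = kummerChar χ s N i ((redUnits (pow_dvd_pow p hs)).comp μ) := by
  obtain ⟨l, u, hl⟩ := F.exists_isLine hF _ (fun i h1 h2 => by
    have := h i h1 h2
    rw [teichmullerLift, tate, twist_ofCharacter] at this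
    exact this) hi hid
  refine ⟨_, l, u, hl, ?_⟩
  have := (hl.reduce (pow_dvd_pow p hs)).character_twist_subquotρ (charMod χ 1 ^ (i : ℤ))
  conv_lhs => rw [tate, this]
  rfl

/-- The converse of `exists_isLine_of_kummer`. -/
lemma FilRep.IsLine.kummer {χ : Γ →ₜ* ℤ_[p]ˣ} (hs : 1 ≤ s) {F : FilRep.{u, v} Γ (p ^ s)} {N : ℤ}
    {i : ℕ} {μ : Γ →* (ZMod (p ^ s))ˣ} {l : F.V →ₗ[ZMod (p ^ s)] ZMod (p ^ s)} {u : F.V}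
    (h : F.IsLine i μ l u)
    (hμ : μ = kummerChar χ s N i ((redUnits (pow_dvd_pow p hs)).comp μ)) :
    Nonempty ((F.subquotρ i (i - 1)).Equiv
      (tate χ (N - i) (teichmullerLift s (tate χ i ((F.reduce (p ^ 1)).subquotρ i (i - 1)))))) := by
  have := (h.reduce (pow_dvd_pow p hs)).character_twist_subquotρ (charMod χ 1 ^ (i : ℤ))
  rw [teichmullerLift, tate, tate, this, twist_ofCharacter]
  have h' := h.nonempty_equiv
  rw [hμ] at h'
  exact h'

end Kummer

/-! ### Degree-two cohomology of wound flags over Demuškin groups -/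

section Demushkin

variable {p : ℕ} [Fact p.Prime]

/-- Over a Demuškin group, cup product with a nonzero class of degree one is onto. -/
lemma IsDemushkin.exists_eq_cup_add {P : Type*} [Group P] [TopologicalSpace P]
    (hP : IsDemushkin p P) {q : ℕ} (hq : q = p) {a : P → ZMod q} (ha : ∀ g h, a (g * h) = a g + a h)
    (ha' : IsLocallyConstant a) (ha0 : ∃ g, a g ≠ 0) {z : P × P → ZMod q} (hz : IsLocallyConstant z)
    (hz' : ∀ g h k, z (h, k) - z (g * h, k) + z (g, h * k) - z (g, h) = 0) :
    ∃ b c : P → ZMod q, (∀ g h, b (g * h) = b g + b h) ∧ IsLocallyConstant b ∧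
      IsLocallyConstant c ∧ ∀ g h, z (g, h) = a g * b h + (c h - c (g * h) + c g) := by
  subst hq
  let A : Z1 (triv (ZMod q) P) := ⟨a, ha', IsCocycle.mem_ker_d1_iff.2 fun g h => by
    simpa using ha g h⟩
  let Z : Z2 (triv (ZMod q) P) := ⟨z, hz, LinearMap.mem_ker.2 (by
    ext ⟨g, h, k⟩
    exact hz' g h k)⟩
  have hA : cup (k := ZMod q) (G := P) (Submodule.Quotient.mk A) ≠ 0 := fun h0 => by
    have h1 : (Submodule.Quotient.mk A : H1 (triv (ZMod q) P)) ∈ LinearMap.ker cup :=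
      LinearMap.mem_ker.2 h0
    rw [hP.leftKernel, Submodule.mem_bot, Submodule.Quotient.mk_eq_zero] at h1
    obtain ⟨g, hg⟩ := ha0
    exact hg (congrFun (congrArg Subtype.val (eq_zero_of_mem_B1 h1)) g)
  obtain ⟨y, hy⟩ : ∃ y, cup (k := ZMod q) (G := P) (Submodule.Quotient.mk A) y ≠ 0 := by
    by_contra! h
    exact hA (LinearMap.ext h)
  obtain ⟨B, rfl⟩ := Submodule.Quotient.mk_surjective _ y
  -- One nonzero product spans `H²`; the scalar `t` is then absorbed into `b`.
  obtain ⟨t, ht⟩ := (finrank_eq_one_iff_of_nonzero' _ hy).1 hP.finrank_H2 (Submodule.Quotient.mk Z)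
  have ht' : (Submodule.Quotient.mk Z : H2 (triv (ZMod q) P)) =
      Submodule.Quotient.mk (t • cupZ A B) := ht.symm
  obtain ⟨c, hc, hc'⟩ := (Submodule.Quotient.eq _).1 ht'
  have hB : IsCocycle (triv (ZMod q) P) B.1 := IsCocycle.mem_ker_d1_iff.1 B.2.2
  refine ⟨t • B.1, c, fun g h => ?_, B.2.1.comp (t * ·), hc, fun g h => ?_⟩
  · simp only [Pi.smul_apply, hB g h, smul_add]
    rfl
  · have : c h - c (g * h) + c g = z (g, h) - t * (a g * B.1 h) := congrFun hc' (g, h)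
    rw [this, Pi.smul_apply, smul_eq_mul]
    ring

end Demushkin

section Unipotent

variable {k : Type*} [CommRing k] {P : Type*} [Group P] [TopologicalSpace P] [ContinuousMul P]
  {M : Type*} [AddCommGroup M] [Module k M]

/-- If cup products with nonzero homomorphisms are onto, then a 2-cocycle with values in a step of
a wound flag with trivial graded pieces is a coboundary in the next step. -/
theorem exists_cochain_of_wound (ρ : Representation k P M)
    (hρ : ∀ v, IsLocallyConstant fun g => ρ g v) (fil : ℕ → Submodule k M) (hmono : Monotone fil)
    (h0 : fil 0 = ⊥) (hstable : ∀ i g, ∀ v ∈ fil i, ρ g v ∈ fil i) {n : ℕ} (l : ℕ → M →ₗ[k] k)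
    (u : ℕ → M) (hu : ∀ i, 1 ≤ i → i ≤ n → u i ∈ fil i) (hlu : ∀ i, 1 ≤ i → i ≤ n → l i (u i) = 1)
    (hker : ∀ i, 1 ≤ i → i ≤ n → ∀ v ∈ fil i, l i v = 0 ↔ v ∈ fil (i - 1))
    (hinv : ∀ i, 1 ≤ i → i ≤ n → ∀ g, ∀ v ∈ fil i, l i (ρ g v) = l i v)
    (hwound : ∀ i, 1 ≤ i → i + 1 ≤ n → ∃ g, l i (ρ g (u (i + 1)) - u (i + 1)) ≠ 0)
    (hcup : ∀ a : P → k, (∀ g h, a (g * h) = a g + a h) → IsLocallyConstant a → (∃ g, a g ≠ 0) →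
      ∀ z : P × P → k, IsLocallyConstant z →
      (∀ g h k, z (h, k) - z (g * h, k) + z (g, h * k) - z (g, h) = 0) →
      ∃ b c : P → k, (∀ g h, b (g * h) = b g + b h) ∧ IsLocallyConstant b ∧ IsLocallyConstant c ∧
        ∀ g h, z (g, h) = a g * b h + (c h - c (g * h) + c g))
    {i : ℕ} (hi : i + 1 ≤ n) {z : P × P → M} (hz : IsLocallyConstant z)
    (hz' : ∀ g h k, ρ g (z (h, k)) - z (g * h, k) + z (g, h * k) - z (g, h) = 0)
    (hzf : ∀ x, z x ∈ fil i) :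
    ∃ c : P → M, IsLocallyConstant c ∧ (∀ g, c g ∈ fil (i + 1)) ∧
      ∀ g h, z (g, h) = ρ g (c h) - c (g * h) + c g := by
  induction i generalizing z with
  | zero =>
    refine ⟨0, IsLocallyConstant.const 0, fun g => zero_mem _, fun g h => ?_⟩
    have := hzf (g, h)
    rw [h0, Submodule.mem_bot] at this
    simp [this]
  | succ i ih =>
    set v := u (i + 2)
    have hv : v ∈ fil (i + 2) := hu _ (by omega) hi
    have hv' : ∀ g, ρ g v - v ∈ fil (i + 1) := fun g => by
      refine (hker (i + 2) (by omega) hi _ (Submodule.sub_mem _ (hstable _ g _ hv) hv)).1 ?_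
      rw [map_sub, hinv (i + 2) (by omega) hi g _ hv, sub_self]
    set w := u (i + 1)
    have hw : w ∈ fil (i + 1) := hu _ (by omega) (by omega)
    have hlw : l (i + 1) w = 1 := hlu _ (by omega) (by omega)
    have hker' := hker (i + 1) (by omega) (by omega)
    have hinv' := hinv (i + 1) (by omega) (by omega)
    -- The class of the extension of line `i + 2` by line `i + 1`. It is a homomorphism because the
    -- action on lines is trivial, and it is nonzero by `hwound`.
    let a : P → k := fun g => l (i + 1) (ρ g v - v)
    have ha : ∀ g h, a (g * h) = a g + a h := fun g h => by
      have : ρ (g * h) v - v = ρ g (ρ h v - v) + (ρ g v - v) := by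
        rw [map_mul, Module.End.mul_apply, map_sub]; abel
      simp only [a]
      rw [this, map_add, hinv' g _ (hv' h), add_comm]
    obtain ⟨b, c, hb, hb', hc, hz1⟩ := hcup a ha ((hρ v).comp fun x => l (i + 1) (x - v))
      (hwound (i + 1) (by omega) hi) (fun x => l (i + 1) (z x)) (hz.comp _) (fun g h k => by
        have := congrArg (l (i + 1)) (hz' g h k)
        rwa [map_sub, map_add, map_sub, map_zero, hinv' g _ (hzf _)] at this)
    -- In line `i + 1`, the coboundary of `b • v` becomes `a ∪ b` and that of `c • w` becomes the
    -- coboundary of `c`. Subtracting both pushes `z` down into `fil i`.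
    let e : P → M := fun g => b g • v + c g • w
    have he : IsLocallyConstant e :=
      (hb'.comp₂ hc fun x y => x • v + y • w : )
    have hρe : IsLocallyConstant fun x : P × P => ρ x.1 (e x.2) := by
      have : (fun x : P × P => ρ x.1 (e x.2)) =
          fun x => b x.2 • ρ x.1 v + c x.2 • ρ x.1 w := by
        ext x; simp [e]
      rw [this]
      exact ((hb'.comp_continuous continuous_snd).comp₂ ((hρ v).comp_continuous continuous_fst)
        (· • ·)).add ((hc.comp_continuous continuous_snd).comp₂
        ((hρ w).comp_continuous continuous_fst) (· • ·))
    let z' : P × P → M := fun x => z x - (ρ x.1 (e x.2) - e (x.1 * x.2) + e x.1)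
    have hz'LC : IsLocallyConstant z' :=
      hz.sub ((hρe.sub (he.comp_continuous continuous_mul)).add (he.comp_continuous continuous_fst))
    have hde : ∀ g h, ρ g (e h) - e (g * h) + e g =
        b h • (ρ g v - v) + (c h • (ρ g w - w) + (c h - c (g * h) + c g) • w) := fun g h => by
      simp only [e, hb, map_add, map_smul, smul_sub, add_smul, sub_smul]
      abel
    obtain ⟨f, hf, hf', hfz⟩ := ih (by omega) (z := z') hz'LC (fun g h k => by
        simp only [z', map_sub, map_add]
        rw [← sub_eq_zero.2 (hz' g h k), mul_assoc, map_mul, Module.End.mul_apply]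
        abel) (fun ⟨g, h⟩ => by
        refine (hker' _ ?_).1 ?_
        · refine Submodule.sub_mem _ (hzf _) ?_
          rw [hde]
          exact Submodule.add_mem _ (Submodule.smul_mem _ _ (hv' g)) (Submodule.add_mem _
            (Submodule.smul_mem _ _ (Submodule.sub_mem _ (hstable _ g _ hw) hw))
            (Submodule.smul_mem _ _ hw))
        · simp only [z']
          rw [map_sub, hde, hz1 g h]
          simp only [map_add, map_smul, map_sub (l (i + 1)) (ρ g w), hinv' g w hw, hlw, smul_eq_mul,
            sub_self, mul_zero, mul_one, zero_add, a]
          ring)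
    refine ⟨f + e, hf.add he, fun g => ?_, fun g h => ?_⟩
    · exact Submodule.add_mem _ (hmono (Nat.le_succ _) (hf' g)) (Submodule.add_mem _
        (Submodule.smul_mem _ _ hv) (Submodule.smul_mem _ _ (hmono (Nat.le_succ _) hw)))
    · have := hfz g h
      simp only [z', sub_eq_iff_eq_add] at this
      rw [this]
      simp only [Pi.add_apply, map_add]
      abel

end Unipotent

/-! ### Lifting from `(ℤ/p^s)(1)` to `(ℤ/p^(s+1))(1)` -/

section WeakHilbert90

variable {p : ℕ}

/-- Multiplication by `p`, from `ℤ/p^s` to `ℤ/p^(s+1)`. -/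
def mulPrime (p s : ℕ) : ZMod (p ^ s) →+ ZMod (p ^ (s + 1)) :=
  ZMod.lift (p ^ s) ⟨(AddMonoidHom.mulLeft (p : ZMod (p ^ (s + 1)))).comp (Int.castAddHom _), by
    have : ((p ^ (s + 1) : ℕ) : ZMod (p ^ (s + 1))) = 0 := ZMod.natCast_self _
    simpa [pow_succ'] using this⟩

/-- The reduction `ℤ/p^(s+1) → ℤ/p^s`. -/
abbrev redSucc (p s : ℕ) : ZMod (p ^ (s + 1)) →+* ZMod (p ^ s) :=
  ZMod.castHom (pow_dvd_pow p s.le_succ) _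

lemma mulPrime_redSucc (s : ℕ) (x : ZMod (p ^ (s + 1))) :
    mulPrime p s (redSucc p s x) = p * x := by
  obtain ⟨k, rfl⟩ := ZMod.intCast_surjective x
  rw [map_intCast]
  exact ZMod.lift_coe _ _ k

lemma redSucc_mulPrime (s : ℕ) (y : ZMod (p ^ (s + 1))) :
    redSucc p (s + 1) (mulPrime p (s + 1) y) = mulPrime p s (redSucc p s y) := by
  obtain ⟨x, rfl⟩ := ZMod.castHom_surjective (pow_dvd_pow p (s + 1).le_succ) y
  rw [mulPrime_redSucc, mulPrime_redSucc, map_mul, map_natCast]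

variable [Fact p.Prime]

lemma mulPrime_injective (s : ℕ) : Function.Injective (mulPrime p s) := by
  refine (injective_iff_map_eq_zero _).2 fun y hy => ?_
  obtain ⟨x, rfl⟩ := ZMod.castHom_surjective (pow_dvd_pow p s.le_succ) y
  rw [mulPrime_redSucc] at hy
  obtain ⟨k, rfl⟩ := ZMod.intCast_surjective x
  have hp : (p : ℤ) ≠ 0 := by exact_mod_cast (Fact.out : p.Prime).ne_zero
  have h1 : ((p * k : ℤ) : ZMod (p ^ (s + 1))) = 0 := by exact_mod_cast hy
  rw [ZMod.intCast_zmod_eq_zero_iff_dvd, pow_succ', Nat.cast_mul] at h1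
  rw [map_intCast, ZMod.intCast_zmod_eq_zero_iff_dvd]
  exact (mul_dvd_mul_iff_left hp).1 h1

variable {Γ : Type*} [Group Γ] [TopologicalSpace Γ] (χ : Γ →ₜ* ℤ_[p]ˣ)

lemma castHom_tateOne {s t : ℕ} (h : t ≤ s) (g : Γ) (x : ZMod (p ^ s)) :
    ZMod.castHom (pow_dvd_pow p h) (ZMod (p ^ t)) (tateOne χ s g x) =
      tateOne χ t g (ZMod.castHom (pow_dvd_pow p h) _ x) := by
  have := congrArg Units.val (redUnits_charMod χ h g)
  rw [tateOne, tateOne, ofCharacter_apply, ofCharacter_apply, map_mul, ← this]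
  rfl

lemma mulPrime_tateOne (s : ℕ) (g : Γ) (y : ZMod (p ^ s)) :
    mulPrime p s (tateOne χ s g y) = tateOne χ (s + 1) g (mulPrime p s y) := by
  obtain ⟨x, rfl⟩ := ZMod.castHom_surjective (pow_dvd_pow p s.le_succ) y
  rw [← castHom_tateOne χ s.le_succ, mulPrime_redSucc, mulPrime_redSucc]
  simp only [tateOne, ofCharacter_apply]
  ring

variable {χ} {P : Subgroup Γ} [IsTopologicalGroup Γ] [CompactSpace Γ] [TotallyDisconnectedSpace Γ]

/-- The hypothesis is about classes. The error between cocycles is the coboundary of some `m` mod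
`p`, and the coboundary of a lift `x` of `m` is subtracted. -/
lemma exists_lift_of_surjective_redH1 {r : ℕ} (hr : 1 ≤ r)
    (h : Function.Surjective (redH1 χ hr P)) {c : P → ZMod (p ^ 1)} (hc : IsLocallyConstant c)
    (hc' : IsCocycle ((tateOne χ 1).comp P.subtype) c) :
    ∃ C : P → ZMod (p ^ r), IsLocallyConstant C ∧ IsCocycle ((tateOne χ r).comp P.subtype) C ∧
      ∀ g, redOne p hr (C g) = c g := by
  obtain ⟨y, hy⟩ := h (Submodule.Quotient.mk ⟨c, hc, IsCocycle.mem_ker_d1_iff.2 hc'⟩)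
  obtain ⟨C, rfl⟩ := Submodule.Quotient.mk_surjective _ y
  obtain ⟨m, hm⟩ := (Submodule.Quotient.eq _).1 hy
  obtain ⟨x, rfl⟩ := ZMod.castHom_surjective (pow_dvd_pow p hr) m
  have hd := IsCocycle.coboundary ((tateOne χ r).comp P.subtype) x
  refine ⟨C.1 - d0 ((tateOne χ r).comp P.subtype) x, ?_,
    (IsCocycle.mem_ker_d1_iff.1 C.2.2).sub hd, fun g => ?_⟩
  · obtain ⟨U, hU⟩ := exists_openNormalSubgroup_charMod χ r
    have hχ : IsLocallyConstant (charMod χ r) :=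
      isLocallyConstant_of_openNormalSubgroup U fun g u hu => by rw [map_mul, hU u hu, mul_one]
    exact C.2.1.sub (((hχ.comp_continuous continuous_subtype_val).comp
      fun a : (ZMod (p ^ r))ˣ => (a : ZMod (p ^ r)) * x - x : ))
  · have h1 : tateOne χ 1 g (redOne p hr x) - redOne p hr x = redOne p hr (C.1 g) - c g :=
      congrFun hm g
    have h2 : redOne p hr (tateOne χ r g x) = tateOne χ 1 g (redOne p hr x) :=
      castHom_tateOne χ hr g x
    change redOne p hr (C.1 g - (tateOne χ r g x - x)) = c g
    rw [map_sub, map_sub, h2, h1]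
    abel

/-- The weak Hilbert 90 property allows to lift cocycles one step at a time. -/
theorem exists_lift_of_wH90
    (h : ∀ (r : ℕ) (hr : 2 ≤ r), Function.Surjective (redH1 χ (one_le_two.trans hr) P))
    {s : ℕ} (hs : 1 ≤ s) {c : P → ZMod (p ^ s)} (hc : IsLocallyConstant c)
    (hc' : IsCocycle ((tateOne χ s).comp P.subtype) c) :
    ∃ C : P → ZMod (p ^ (s + 1)), IsLocallyConstant C ∧
      IsCocycle ((tateOne χ (s + 1)).comp P.subtype) C ∧ ∀ g, redSucc p s (C g) = c g := by
  induction s, hs using Nat.le_induction with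
  | base => exact exists_lift_of_surjective_redH1 _ (h 2 le_rfl) hc hc'
  | succ s hs ih =>
    let r1 : ZMod (p ^ (s + 1)) →+* ZMod (p ^ 1) := redOne p (Nat.le_add_left 1 s)
    -- The hypothesis concerns reduction to `𝔽_p` only. So `c` mod `p` is lifted all the way up; the
    -- difference of `c` and this lift is divisible by `p`, and its quotient `D` has coefficients
    -- mod `p^s`, where induction applies. The answer is `C + p D'`.
    obtain ⟨C, hC, hC', hCc⟩ := exists_lift_of_surjective_redH1 _ (h (s + 2) (by omega))
      (c := r1 ∘ c) (hc.comp _)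
      (hc'.map r1.toAddMonoidHom (fun g x => castHom_tateOne χ (Nat.le_add_left 1 s) (g : Γ) x))
    have hC₁ : IsCocycle ((tateOne χ (s + 1)).comp P.subtype) (redSucc p (s + 1) ∘ C) :=
      hC'.map (redSucc p (s + 1)).toAddMonoidHom
        (fun g x => castHom_tateOne χ (s + 1).le_succ (g : Γ) x)
    have hD : ∀ g, ∃ y, mulPrime p s y = (c - redSucc p (s + 1) ∘ C) g := fun g => by
      have h0 : r1 ((c - redSucc p (s + 1) ∘ C) g) = 0 := by
        have h1 : r1 (redSucc p (s + 1) (C g)) = redOne p (Nat.le_add_left 1 (s + 1)) (C g) :=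
          RingHom.congr_fun (Subsingleton.elim (r1.comp (redSucc p (s + 1))) _) _
        have h2 : redOne p (Nat.le_add_left 1 (s + 1)) (C g) = r1 (c g) := hCc g
        rw [Pi.sub_apply, map_sub, Function.comp_apply, h1, h2, sub_self]
      obtain ⟨t, ht⟩ := FilRep.IsLine.exists_eq_mul_of_castHom_eq_zero _ h0
      exact ⟨redSucc p s t, by rw [mulPrime_redSucc, ht, pow_one]⟩
    let D : P → ZMod (p ^ s) := Function.invFun (mulPrime p s) ∘ (c - redSucc p (s + 1) ∘ C)
    have hDj : ∀ g, mulPrime p s (D g) = (c - redSucc p (s + 1) ∘ C) g := fun g =>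
      Function.invFun_eq (hD g)
    obtain ⟨D', hD', hD'', hD'D⟩ := ih (c := D) ((hc.sub (hC.comp _)).comp _) fun g k => by
      refine mulPrime_injective s ?_
      have := (hc'.sub hC₁) g k
      rw [← hDj, ← hDj, ← hDj] at this
      rw [this, map_add]
      congr 1
      exact (mulPrime_tateOne χ s g _).symm
    refine ⟨C + mulPrime p (s + 1) ∘ D', hC.add (hD'.comp _), hC'.add
      (hD''.map _ fun g x => mulPrime_tateOne χ (s + 1) (g : Γ) x), fun g => ?_⟩
    rw [Pi.add_apply, map_add, Function.comp_apply, redSucc_mulPrime, hD'D, hDj]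
    simp

end WeakHilbert90

/-! ### Recognizing reductions, and extending a filtered module by a line -/

namespace FilRep

variable {Γ : Type u} [Group Γ] [TopologicalSpace Γ] {n m : ℕ}

section Reduction

variable {F : FilRep.{u, v} Γ n} {G : FilRep.{u, v} Γ m}

/-- An equivariant surjection with kernel `m V`, which is strictly compatible with the filtrations,
identifies its target with the reduction mod `m`. -/
def isoReduce (q : F.V →+ G.V) (hq : Function.Surjective q) (hker : ∀ x, q x = 0 → ∃ y, x = m • y)
    (hρ : ∀ g x, q (F.ρ g x) = G.ρ g (q x))
    (hfil : ∀ i y, y ∈ G.fil i ↔ ∃ x ∈ F.fil i, q x = y) : Iso (F.reduce m) G where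
  equiv := LinearEquiv.ofBijective
    (show (F.reduce m).V →ₗ[ZMod m] G.V from q.toIntLinearMap.liftBaseChange (ZMod m)) (by
      have key : ∀ x, (show (F.reduce m).V →ₗ[ZMod m] G.V from
        q.toIntLinearMap.liftBaseChange (ZMod m)) (F.toReduce m x) = q x :=
        fun x => one_smul (ZMod m) (q x)
      refine ⟨(injective_iff_map_eq_zero _).2 fun y hy => ?_, fun y => ?_⟩
      · obtain ⟨x, rfl⟩ := F.toReduce_surjective m y
        rw [key] at hy
        exact (F.toReduce_eq_zero_iff m x).2 (hker x hy)
      · obtain ⟨x, rfl⟩ := hq y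
        exact ⟨_, key x⟩)
  equivariant g y := by
    obtain ⟨x, rfl⟩ := F.toReduce_surjective m y
    rw [reduce_ρ_toReduce]
    exact (one_smul (ZMod m) _).trans ((hρ g x).trans
      (congrArg (G.ρ g) (one_smul (ZMod m) (q x)).symm))
  map_fil i := by
    ext y
    rw [hfil]
    constructor
    · rintro ⟨z, hz, rfl⟩
      obtain ⟨x, hx, rfl⟩ := (F.mem_reduce_fil_iff m i z).1 hz
      exact ⟨x, hx, (one_smul (ZMod m) _).symm⟩
    · rintro ⟨x, hx, rfl⟩
      exact ⟨F.toReduce m x, (F.mem_reduce_fil_iff m i _).2 ⟨x, hx, rfl⟩, one_smul (ZMod m) _⟩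

lemma isoReduce_toReduce (q : F.V →+ G.V) (hq : Function.Surjective q)
    (hker : ∀ x, q x = 0 → ∃ y, x = m • y) (hρ : ∀ g x, q (F.ρ g x) = G.ρ g (q x))
    (hfil : ∀ i y, y ∈ G.fil i ↔ ∃ x ∈ F.fil i, q x = y) (x : F.V) :
    (isoReduce q hq hker hρ hfil).equiv (F.toReduce m x) = q x :=
  one_smul (ZMod m) (q x)

variable {B : FilRep.{u, v} Γ n} {k : ℕ} (φ : Iso (G.trunc k) (B.reduce m))

/-- The surjection from a lift of `V_k` to `V_k`. -/
def liftMap : B.V →+ (G.trunc k).V :=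
  φ.equiv.symm.toAddEquiv.toAddMonoidHom.comp (B.toReduce m)

lemma equiv_liftMap (w : B.V) : φ.equiv (liftMap φ w) = B.toReduce m w :=
  φ.equiv.apply_symm_apply _

lemma liftMap_surjective : Function.Surjective (liftMap φ) := fun v => by
  obtain ⟨w, hw⟩ := B.toReduce_surjective m (φ.equiv v)
  exact ⟨w, φ.equiv.injective ((equiv_liftMap φ w).trans hw)⟩

lemma liftMap_eq_zero_iff (w : B.V) : liftMap φ w = 0 ↔ ∃ y, w = m • y := by
  rw [← B.toReduce_eq_zero_iff, ← equiv_liftMap φ]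
  exact (LinearEquiv.map_eq_zero_iff φ.equiv).symm

lemma liftMap_ρ (g : Γ) (w : B.V) : liftMap φ (B.ρ g w) = (G.trunc k).ρ g (liftMap φ w) :=
  φ.equiv.injective (by rw [φ.equivariant, equiv_liftMap, equiv_liftMap, reduce_ρ_toReduce])

lemma liftMap_smul (h : m ∣ n) (a : ZMod n) (w : B.V) :
    liftMap φ (a • w) = ZMod.castHom h (ZMod m) a • liftMap φ w :=
  φ.equiv.injective (by
    rw [φ.equiv.map_smul, equiv_liftMap, equiv_liftMap, toReduce_smul _ _ h])

lemma mem_fil_iff_liftMap (i : ℕ) (v : (G.trunc k).V) :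
    v ∈ (G.trunc k).fil i ↔ ∃ w ∈ B.fil i, liftMap φ w = v := by
  constructor
  · intro hv
    have : φ.equiv v ∈ (B.reduce m).fil i := φ.map_fil i ▸ Submodule.mem_map_of_mem hv
    obtain ⟨w, hw, hw'⟩ := (B.mem_reduce_fil_iff m i _).1 this
    exact ⟨w, hw, φ.equiv.injective ((equiv_liftMap φ w).trans hw')⟩
  · rintro ⟨w, hw, rfl⟩
    have : B.toReduce m w ∈ (B.reduce m).fil i := (B.mem_reduce_fil_iff m i _).2 ⟨w, hw, rfl⟩
    rw [← φ.map_fil i] at this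
    obtain ⟨v, hv, hv'⟩ := this
    rwa [← φ.equiv.injective (hv'.trans (equiv_liftMap φ w).symm)]

end Reduction

section Extension

variable (B : FilRep.{u, v} Γ n) (c : Γ →* (ZMod n)ˣ) {e : Γ → B.V}
  (he : IsCocycle (twist c⁻¹ B.ρ) e)
  (hU : ∃ U : OpenNormalSubgroup Γ, ∀ g ∈ U, c g = 1 ∧ e g = 0) (d : ℕ)

/-- The extension of the line with character `c` by `B`, given by a cocycle with values in the
twist of `B` by `c⁻¹`; the filtration of `B` is cut at `d`. -/
def extension : FilRep.{u, v} Γ n where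
  V := B.V × ZMod n
  ρ :=
    { toFun := fun g => LinearMap.prod (B.ρ g ∘ₗ LinearMap.fst _ _ _ +
          LinearMap.toSpanSingleton _ _ ((c g : ZMod n) • e g) ∘ₗ LinearMap.snd _ _ _)
        ((c g : ZMod n) • LinearMap.snd _ _ _)
      map_one' := by
        refine LinearMap.ext fun x => ?_
        simp [he.map_one]
      map_mul' := fun g h => by
        refine LinearMap.ext fun x => Prod.ext ?_ ?_
        · change B.ρ (g * h) x.1 + x.2 • (c (g * h) : ZMod n) • e (g * h) =
            B.ρ g (B.ρ h x.1 + x.2 • (c h : ZMod n) • e h) +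
              ((c h : ZMod n) * x.2) • (c g : ZMod n) • e g
          have h1 : (c g : ZMod n) • ((c⁻¹ g : (ZMod n)ˣ) : ZMod n) • B.ρ g (e h) =
              B.ρ g (e h) := by
            rw [smul_smul, MonoidHom.inv_apply, Units.mul_inv, one_smul]
          rw [he g h, twist_apply, map_mul, map_mul, Units.val_mul, mul_comm (c g : ZMod n),
            mul_smul, smul_add, h1, map_add, map_smul, map_smul, Module.End.mul_apply, smul_add, smul_add,
            mul_comm, mul_smul]
          abel
        · simp [mul_assoc] }
  continuous := by
    obtain ⟨U, hU⟩ := hU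
    obtain ⟨U', hU'⟩ := B.continuous
    refine ⟨U ⊓ U', fun g hg => ?_⟩
    have h1 := hU g hg.1
    have h2 := hU' g hg.2
    refine LinearMap.ext fun x => ?_
    simp [h1.1, h1.2, h2]
  -- In use `B` has rank `d - 1`, so the new line enters exactly at the index `d`.
  fil i := if i < d then (B.fil i).map (LinearMap.inl _ _ _) else ⊤
  mono i j h := by
    by_cases hj : j < d
    · simp only [if_pos hj, if_pos (h.trans_lt hj)]
      exact Submodule.map_mono (B.mono h)
    · simp only [if_neg hj, le_top]
  stable i g := by
    by_cases hi : i < d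
    · simp only [if_pos hi]
      rintro _ ⟨w, hw, rfl⟩
      refine ⟨B.ρ g w, B.stable i g hw, ?_⟩
      simp
    · simp only [if_neg hi]
      exact fun _ _ => trivial

variable {B c} {d}

lemma extension_ρ (g : Γ) (x : (extension B c he hU d).V) :
    (extension B c he hU d).ρ g x = (B.ρ g x.1 + x.2 • (c g : ZMod n) • e g, c g * x.2) := rfl

lemma mem_extension_fil {i : ℕ} (hi : i < d) (x : (extension B c he hU d).V) :
    x ∈ (extension B c he hU d).fil i ↔ x.1 ∈ B.fil i ∧ x.2 = 0 := by
  simp only [extension, if_pos hi]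
  constructor
  · rintro ⟨w, hw, rfl⟩
    exact ⟨hw, rfl⟩
  · rintro ⟨h1, h2⟩
    exact ⟨x.1, h1, Prod.ext rfl h2.symm⟩

lemma extension_fil_eq_top {i : ℕ} (hi : d ≤ i) : (extension B c he hU d).fil i = ⊤ :=
  if_neg (not_lt.2 hi)

lemma IsLine.extension {i : ℕ} {μ : Γ →* (ZMod n)ˣ} {l : B.V →ₗ[ZMod n] ZMod n} {u : B.V}
    (h : B.IsLine i μ l u) (hi : i < d) :
    (FilRep.extension B c he hU d).IsLine i μ (l ∘ₗ LinearMap.fst _ _ _) (u, 0) where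
  mem := (mem_extension_fil he hU hi _).2 ⟨h.mem, rfl⟩
  apply_self := h.apply_self
  eq_zero_iff x hx := by
    obtain ⟨h1, h2⟩ := (mem_extension_fil he hU hi _).1 hx
    rw [mem_extension_fil he hU (by omega)]
    exact (h.eq_zero_iff _ h1).trans ⟨fun h => ⟨h, h2⟩, And.left⟩
  apply_ρ g x hx := by
    obtain ⟨h1, h2⟩ := (mem_extension_fil he hU hi _).1 hx
    rw [extension_ρ, h2, zero_smul, add_zero]
    exact h.apply_ρ g _ h1

lemma extension_isLine (hd : 1 ≤ d) (hB : B.fil (d - 1) = ⊤) :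
    (extension B c he hU d).IsLine d c (LinearMap.snd _ _ _) (0, 1) where
  mem := by rw [extension_fil_eq_top he hU le_rfl]; trivial
  apply_self := rfl
  eq_zero_iff x hx := by
    rw [mem_extension_fil he hU (by omega), hB]
    exact ⟨fun h => ⟨trivial, h⟩, And.right⟩
  apply_ρ g x hx := rfl

lemma extension_isCompleteFlag [Nontrivial (ZMod n)] (hd : 1 ≤ d) (hB : B.IsCompleteFlag (d - 1)) :
    (extension B c he hU d).IsCompleteFlag d := by
  have hlt : ∀ i, i < d → Nonempty ((extension B c he hU d).fil i ≃ₗ[ZMod n] B.fil i) :=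
    fun i hi => by
      have : (extension B c he hU d).fil i = (B.fil i).map (LinearMap.inl _ _ (ZMod n)) := if_pos hi
      rw [this]
      exact ⟨(Submodule.equivMapOfInjective _ LinearMap.inl_injective _).symm⟩
  have htop : Nonempty ((extension B c he hU d).fil d ≃ₗ[ZMod n] B.fil (d - 1) × ZMod n) := by
    rw [extension_fil_eq_top he hU le_rfl, hB.top]
    exact ⟨Submodule.topEquiv.trans (Submodule.topEquiv.symm.prodCongr (LinearEquiv.refl _ _))⟩
  have h1 := hB.free
  have h2 := hB.finite
  have h3 := hB.finrank
  have := h1 (d - 1) le_rfl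
  have := h2 (d - 1) le_rfl
  refine ⟨?_, extension_fil_eq_top he hU le_rfl, fun i hi => ?_, fun i hi => ?_, fun i hi => ?_⟩
  · refine (Submodule.eq_bot_iff _).2 fun x hx => ?_
    obtain ⟨h1, h2⟩ := (mem_extension_fil he hU hd _).1 hx
    rw [hB.zero, Submodule.mem_bot] at h1
    exact Prod.ext h1 h2
  all_goals
    rcases hi.lt_or_eq with hi | rfl
    · obtain ⟨f⟩ := hlt i hi
      have := h1 i (by omega)
      have := h2 i (by omega)
      first
      | exact Module.Free.of_equiv f.symm
      | exact Module.Finite.equiv f.symm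
      | exact f.finrank_eq.trans (h3 i (by omega))
    · obtain ⟨f⟩ := htop
      first
      | exact Module.Free.of_equiv f.symm
      | exact Module.Finite.equiv f.symm
      | rw [f.finrank_eq, Module.finrank_prod, h3 _ le_rfl, Module.finrank_self]; omega

/-- The truncation of an extension. -/
def extensionTrunc (hd : 1 ≤ d) (hB : B.fil (d - 1) = ⊤) :
    Iso ((extension B c he hU d).trunc (d - 1)) B where
  equiv := LinearEquiv.ofBijective
    (LinearMap.fst _ _ _ ∘ₗ ((extension B c he hU d).fil (d - 1)).subtype) (by
      refine ⟨fun x y hxy => Subtype.ext (Prod.ext hxy ?_), fun w =>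
        ⟨⟨(w, 0), (mem_extension_fil he hU (by omega) _).2 ⟨hB ▸ trivial, rfl⟩⟩, rfl⟩⟩
      exact ((mem_extension_fil he hU (by omega) _).1 x.2).2.trans
        ((mem_extension_fil he hU (by omega) _).1 y.2).2.symm)
  equivariant g x := by
    have h2 : x.1.2 = 0 := ((mem_extension_fil he hU (by omega) _).1 x.2).2
    change B.ρ g x.1.1 + x.1.2 • (c g : ZMod n) • e g = B.ρ g x.1.1
    rw [h2, zero_smul, add_zero]
  map_fil i := by
    ext w
    constructor
    · rintro ⟨x, hx, rfl⟩
      by_cases hi : i < d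
      · exact ((mem_extension_fil he hU hi _).1 hx).1
      · have := B.mono (show d - 1 ≤ i by omega)
        rw [hB] at this
        exact this trivial
    · intro hw
      refine ⟨⟨(w, 0), (mem_extension_fil he hU (by omega) _).2 ⟨hB ▸ trivial, rfl⟩⟩, ?_, rfl⟩
      change (w, 0) ∈ (extension B c he hU d).fil i
      by_cases hi : i < d
      · exact (mem_extension_fil he hU hi _).2 ⟨hw, rfl⟩
      · rw [extension_fil_eq_top he hU (not_lt.1 hi)]
        trivial

end Extension

end FilRep

lemma _root_.ContCoh.IsCocycle.congr {R : Type*} [CommRing R] {G : Type*} [Group G] {A : Type*}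
    [AddCommGroup A] [Module R A] {ρ ρ' : Representation R G A} {f : G → A} (hf : IsCocycle ρ f)
    (h : ∀ g a, ρ g a = ρ' g a) : IsCocycle ρ' f := fun g k => by rw [hf g k, h]

/-- This serves for `(g, h) ↦ g E(h)`, where the action is known to be locally constant one vector
at a time. -/
lemma _root_.IsLocallyConstant.apply₂ {X Y Z : Type*} [TopologicalSpace X] {f : X → Y}
    (hf : IsLocallyConstant f) {F : X → Y → Z} (hF : ∀ y, IsLocallyConstant fun x => F x y) :
    IsLocallyConstant fun x => F x (f x) := by
  rw [IsLocallyConstant.iff_eventually_eq]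
  intro x
  filter_upwards [hf.eventually_eq x, (hF (f x)).eventually_eq x] with y h1 h2
  rw [h1, h2]

lemma nsmul_eq_zero_of_module_zmod (n : ℕ) {A : Type*} [AddCommGroup A] [Module (ZMod n) A]
    (a : A) : n • a = 0 := by
  rw [← Nat.cast_smul_eq_nsmul (ZMod n), ZMod.natCast_self, zero_smul]

/-! ### Woundness over a Sylow subgroup, and multiplication by `p^r` -/

namespace FilRep

variable {p : ℕ} [Fact p.Prime] {Γ : Type u} [Group Γ] [TopologicalSpace Γ] {n : ℕ}

lemma IsLine.char_eq_one {F : FilRep.{u, v} Γ n} {i : ℕ} {μ : Γ →* (ZMod n)ˣ}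
    {l : F.V →ₗ[ZMod n] ZMod n} {u : F.V} (h : F.IsLine i μ l u) {g : Γ} (hg : F.ρ g = 1) :
    μ g = 1 := by
  have := h.apply_ρ g u h.mem
  rw [hg, Module.End.one_apply, h.apply_self, mul_one] at this
  exact Units.ext this.symm

lemma isLocallyConstant_ρ [IsTopologicalGroup Γ] (F : FilRep.{u, v} Γ n) (w : F.V) :
    IsLocallyConstant fun g => F.ρ g w := by
  obtain ⟨U, hU⟩ := F.continuous
  exact isLocallyConstant_of_openNormalSubgroup U fun g u hu => by rw [map_mul, hU u hu, mul_one]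

variable [IsTopologicalGroup Γ] [CompactSpace Γ] [TotallyDisconnectedSpace Γ]

/-- An extension of lines over `𝔽_p` which does not split remains nonsplit over a pro-`p`-Sylow
subgroup. -/
lemma exists_ne_zero_of_not_isSplitVector {P : Subgroup Γ} (hP : IsProPSylow p P)
    {G : FilRep.{u, v} Γ (p ^ 1)} {i : ℕ} {μ μ' : Γ →* (ZMod (p ^ 1))ˣ}
    {l l' : G.V →ₗ[ZMod (p ^ 1)] ZMod (p ^ 1)} {u u' : G.V} (h : G.IsLine i μ l u)
    (h' : G.IsLine (i + 1) μ' l' u') (hns : ¬ ∃ v, G.IsSplitVector i v) :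
    ∃ g : P, l (G.ρ g u' - u') ≠ 0 := by
  by_contra! hP'
  obtain ⟨U, hU⟩ := G.continuous
  have hfil : ∀ g, G.ρ g u' - (μ' g : ZMod (p ^ 1)) • u' ∈ G.fil i := fun g => by
    refine (h'.eq_zero_iff _ (Submodule.sub_mem _ (G.stable _ g h'.mem)
      (Submodule.smul_mem _ _ h'.mem))).1 ?_
    rw [map_sub, map_smul, h'.apply_ρ g u' h'.mem, smul_eq_mul, sub_self]
  -- The cocycle of the extension of line `i + 1` by line `i`, twisted by `μ'⁻¹`. If it vanishes on
  -- `P`, it is a coboundary on `Γ`.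
  let a : Γ → ZMod (p ^ 1) := fun g =>
    ((μ' g)⁻¹ : (ZMod (p ^ 1))ˣ) * l (G.ρ g u' - (μ' g : ZMod (p ^ 1)) • u')
  have ha' : ∀ g, μ' g * a g = l (G.ρ g u' - (μ' g : ZMod (p ^ 1)) • u') := fun g => by
    simp only [a]
    rw [← mul_assoc, Units.mul_inv, one_mul]
  have ha : IsCocycle (ofCharacter (μ * μ'⁻¹)) a := fun g k => by
    have e1 : G.ρ (g * k) u' - (μ' (g * k) : ZMod (p ^ 1)) • u' =
        G.ρ g (G.ρ k u' - (μ' k : ZMod (p ^ 1)) • u') +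
          (μ' k : ZMod (p ^ 1)) • (G.ρ g u' - (μ' g : ZMod (p ^ 1)) • u') := by
      rw [map_mul, Module.End.mul_apply, map_sub, map_smul, smul_sub, smul_smul, map_mul,
        Units.val_mul, mul_comm (μ' k : ZMod (p ^ 1))]
      abel
    have e2 := congrArg l e1
    rw [map_add, h.apply_ρ g _ (hfil k), map_smul, ← ha', ← ha', ← ha', smul_eq_mul, map_mul,
      Units.val_mul] at e2
    rw [ofCharacter_apply, MonoidHom.mul_apply, MonoidHom.inv_apply, Units.val_mul]
    refine (μ' g * μ' k).isUnit.mul_left_cancel ?_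
    rw [Units.val_mul, e2]
    have := Units.mul_inv (μ' g)
    linear_combination (-(μ g : ZMod (p ^ 1)) * (μ' k * a k)) * this
  obtain ⟨s, hs⟩ := exists_coboundary_of_sylow hP (nsmul_eq_zero_of_module_zmod (p ^ 1)) ha
    ⟨U, fun g hg => by
      simp only [a]
      rw [h'.char_eq_one (hU g hg), hU g hg]
      simp⟩ (fun g => by
      simp only [a]
      rw [eq_one_of_isProP hP.isProP ⟨U, fun g hg => h'.char_eq_one (hU g hg)⟩ g.2, Units.val_one,
        one_smul, hP', mul_zero])
  have hu : u ∈ G.fil (i + 1) := G.mono (Nat.le_succ i) h.mem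
  -- Subtracting `s • u` absorbs the coboundary of `s`, so the new vector spans a stable line modulo
  -- `fil (i - 1)`.
  refine hns ⟨u' - s • u, Submodule.sub_mem _ h'.mem (Submodule.smul_mem _ _ hu),
    fun w hw => ⟨l' w, ?_⟩, fun g => ⟨μ' g, ?_⟩⟩
  · have := Submodule.add_mem _ (h'.sub_mem hw)
      (Submodule.smul_mem _ (l' w) (Submodule.smul_mem _ s h.mem))
    rw [smul_sub]
    rwa [sub_add] at this
  · have e1 : G.ρ g (u' - s • u) - (μ' g : ZMod (p ^ 1)) • (u' - s • u) =
        (G.ρ g u' - (μ' g : ZMod (p ^ 1)) • u') - s • (G.ρ g u - (μ' g : ZMod (p ^ 1)) • u) := by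
      rw [map_sub, map_smul, smul_sub, smul_sub, smul_comm]
      abel
    rw [e1]
    refine (h.eq_zero_iff _ (Submodule.sub_mem _ (hfil g) (Submodule.smul_mem _ _
      (Submodule.sub_mem _ (G.stable _ g h.mem) (Submodule.smul_mem _ _ h.mem))))).1 ?_
    rw [map_sub, ← ha', hs, map_smul, map_sub, h.apply_ρ g u h.mem, map_smul, h.apply_self,
      ofCharacter_apply, MonoidHom.mul_apply, MonoidHom.inv_apply, Units.val_mul]
    simp only [smul_eq_mul]
    have := Units.mul_inv (μ' g)
    linear_combination (μ g * s) * this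

/-- Multiplication by `p^r` induces a map `V ⊗ 𝔽_p → V`. -/
lemma exists_mulPow {p r : ℕ} {Γ : Type u} [Group Γ] [TopologicalSpace Γ]
    (B : FilRep.{u, v} Γ (p ^ (r + 1))) :
    ∃ ι : (B.reduce (p ^ 1)).V →+ B.V, ∀ w, ι (B.toReduce (p ^ 1) w) = p ^ r • w := by
  have hs := Function.rightInverse_surjInv (B.toReduce_surjective (p ^ 1))
  refine ⟨(B.toReduce (p ^ 1)).liftOfRightInverse _ hs ⟨nsmulAddMonoidHom (p ^ r), fun w hw => ?_⟩,
    fun w => AddMonoidHom.liftOfRightInverse_comp_apply _ _ hs _ w⟩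
  obtain ⟨y, rfl⟩ := (B.toReduce_eq_zero_iff _ _).1 hw
  change p ^ r • p ^ 1 • y = 0
  rw [smul_smul, ← pow_add]
  exact nsmul_eq_zero_of_module_zmod _ _

end FilRep

/-! ### Lifting cocycles over a Demuškin Sylow subgroup -/

section Lift

variable {p : ℕ} [Fact p.Prime] {Γ : Type u} [Group Γ] [TopologicalSpace Γ]

namespace FilRep

variable {r : ℕ} {B : FilRep.{u, v} Γ (p ^ (r + 1))} {k : ℕ}
  {μ : ℕ → Γ →* (ZMod (p ^ (r + 1)))ˣ} {l : ℕ → B.V →ₗ[ZMod (p ^ (r + 1))] ZMod (p ^ (r + 1))}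
  {u : ℕ → B.V}

lemma exists_eq_mul_prime_of_pow_mul_eq_zero {x : ZMod (p ^ (r + 1))} (hx : (p ^ r : ℕ) • x = 0) :
    ∃ t : ZMod (p ^ (r + 1)), x = (p ^ 1 : ℕ) * t := by
  obtain ⟨k, rfl⟩ := ZMod.intCast_surjective x
  have hp : ((p ^ r : ℕ) : ℤ) ≠ 0 := by
    exact_mod_cast pow_ne_zero r (Fact.out : p.Prime).ne_zero
  have h1 : (((p ^ r : ℕ) * k : ℤ) : ZMod (p ^ (r + 1))) = 0 := by
    rw [← hx, nsmul_eq_mul]; push_cast; rfl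
  rw [ZMod.intCast_zmod_eq_zero_iff_dvd, pow_succ, Nat.cast_mul] at h1
  obtain ⟨t, rfl⟩ := (mul_dvd_mul_iff_left hp).1 h1
  exact ⟨t, by push_cast; ring⟩

/-- This makes multiplication by `p^r` injective from `V ⊗ 𝔽_p` to `V`. The last coordinate is
treated in `ℤ/p^(r+1)`, and the rest by induction along the filtration. -/
lemma exists_eq_prime_smul_of_pow_smul_eq_zero (h0 : B.fil 0 = ⊥)
    (hl : ∀ i, 1 ≤ i → i ≤ k → B.IsLine i (μ i) (l i) (u i)) {w : B.V} (hw : w ∈ B.fil k)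
    (hw0 : p ^ r • w = 0) : ∃ y, w = p ^ 1 • y := by
  induction k generalizing w with
  | zero =>
    rw [h0, Submodule.mem_bot] at hw
    exact ⟨0, by simp [hw]⟩
  | succ k ih =>
    have h := hl (k + 1) (by omega) le_rfl
    obtain ⟨t, ht⟩ := exists_eq_mul_prime_of_pow_mul_eq_zero (x := l (k + 1) w) (by
      rw [← map_nsmul, hw0, map_zero])
    have e1 : l (k + 1) w • u (k + 1) = p ^ 1 • (t • u (k + 1)) := by
      rw [ht, mul_smul, Nat.cast_smul_eq_nsmul]
    have e2 : p ^ r • p ^ 1 • (t • u (k + 1)) = 0 := by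
      rw [smul_smul, ← pow_add]
      exact nsmul_eq_zero_of_module_zmod _ _
    obtain ⟨y, hy⟩ := ih (fun i h1 h2 => hl i h1 (by omega)) (h.sub_mem hw) (by
      rw [smul_sub, hw0, e1, e2, sub_zero])
    exact ⟨y + t • u (k + 1), by rw [smul_add, ← e1, ← hy]; abel⟩

variable [IsTopologicalGroup Γ] [CompactSpace Γ] [TotallyDisconnectedSpace Γ]

/-- Over a Demuškin pro-`p`-Sylow subgroup, a cocycle with values in a twist of a wound flag lifts
as soon as its image in the last graded piece does. -/
theorem exists_lift_of_isDemushkin {P : Subgroup Γ} (hP : IsProPSylow p P) (hD : IsDemushkin p P)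
    (h0 : B.fil 0 = ⊥) (hk : 1 ≤ k) (htop : B.fil k = ⊤)
    (hl : ∀ i, 1 ≤ i → i ≤ k → B.IsLine i (μ i) (l i) (u i)) (hB : IsWound B k)
    {c : Γ →* (ZMod (p ^ (r + 1)))ˣ} (hc : ∃ U : OpenNormalSubgroup Γ, ∀ g ∈ U, c g = 1)
    {G : FilRep.{u, v} Γ (p ^ r)} (φ : Iso (G.trunc k) (B.reduce (p ^ r)))
    {e : P → (G.trunc k).V} (heLC : IsLocallyConstant e)
    (he : IsCocycle ((twist ((redUnits (pow_dvd_pow p r.le_succ)).comp c)⁻¹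
      (G.trunc k).ρ).comp P.subtype) e)
    {C : P → ZMod (p ^ (r + 1))} (hCLC : IsLocallyConstant C)
    (hC : IsCocycle ((ofCharacter (μ k * c⁻¹)).comp P.subtype) C)
    (hCe : ∀ g, redSucc p r (C g) =
      IsLine.redForm B (pow_dvd_pow p r.le_succ) (l k) (φ.equiv (e g))) :
    ∃ f : P → B.V, IsLocallyConstant f ∧ IsCocycle ((twist c⁻¹ B.ρ).comp P.subtype) f ∧
      ∀ g, liftMap φ (f g) = e g := by
  have hp1 : p ^ 1 ∣ p ^ (r + 1) := pow_dvd_pow p (Nat.le_add_left 1 r)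
  have hpr : p ^ r ∣ p ^ (r + 1) := pow_dvd_pow p r.le_succ
  have hk' := hl k hk le_rfl
  set τ : Representation (ZMod (p ^ (r + 1))) Γ B.V := twist c⁻¹ B.ρ with hτ
  have hlτ : ∀ g w, l k (τ g w) = ((μ k * c⁻¹) g : (ZMod (p ^ (r + 1)))ˣ) * l k w := fun g w => by
    rw [hτ, twist_apply, map_smul, hk'.apply_ρ g w (htop ▸ trivial), MonoidHom.mul_apply,
      Units.val_mul, smul_eq_mul]
    ring
  have hπτ : ∀ g w, liftMap φ (τ g w) =
      twist ((redUnits hpr).comp c)⁻¹ (G.trunc k).ρ g (liftMap φ w) := fun g w => by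
    rw [hτ, twist_apply, liftMap_smul φ hpr, liftMap_ρ, twist_apply]
    congr 1
  have hsec : ∀ (v : (G.trunc k).V) (x : ZMod (p ^ (r + 1))),
      redSucc p r x = IsLine.redForm B hpr (l k) (φ.equiv v) →
      ∃ w, liftMap φ w = v ∧ l k w = x := fun v x hvx => by
    obtain ⟨w, rfl⟩ := liftMap_surjective φ v
    rw [equiv_liftMap, IsLine.redForm_toReduce] at hvx
    have : ZMod.castHom hpr (ZMod (p ^ r)) (x - l k w) = 0 := by rw [map_sub, hvx, sub_self]
    obtain ⟨t, ht⟩ := IsLine.exists_eq_mul_of_castHom_eq_zero hpr this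
    -- The last coordinate of `w` is off by `p^r t`; the correction is invisible mod `p^r`.
    refine ⟨w + (p ^ r) • (t • u k), ?_, ?_⟩
    · rw [map_add, (liftMap_eq_zero_iff φ ((p ^ r) • (t • u k))).2 ⟨_, rfl⟩, add_zero]
    · rw [map_add, map_nsmul, map_smul, hk'.apply_self, smul_eq_mul, mul_one, nsmul_eq_mul, ← ht]
      abel
  -- a cochain lifting both `e` and `C`
  classical
  -- The choice is made on pairs of values and not on `P`, so that `E` is locally constant. By `hCe`
  -- the default `0` never occurs.
  let S : (G.trunc k).V × ZMod (p ^ (r + 1)) → B.V := fun x =>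
    if h : redSucc p r x.2 = IsLine.redForm B hpr (l k) (φ.equiv x.1) then (hsec x.1 x.2 h).choose
    else 0
  let E : P → B.V := fun g => S (e g, C g)
  have hELC : IsLocallyConstant E := (heLC.prodMk hCLC).comp S
  have hE : ∀ g, liftMap φ (E g) = e g ∧ l k (E g) = C g := fun g => by
    simp only [E, S, dif_pos (hCe g)]
    exact (hsec _ _ (hCe g)).choose_spec
  obtain ⟨U, hU⟩ := B.continuous
  obtain ⟨U', hU'⟩ := hc
  have hτLC : ∀ w, IsLocallyConstant fun g : P => τ g w := fun w => by
    have : IsLocallyConstant fun g => τ g w :=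
      isLocallyConstant_of_openNormalSubgroup (U ⊓ U') fun g u hu => by
        simp [hτ, hU u hu.1, hU' u hu.2]
    exact this.comp_continuous continuous_subtype_val
  let z : P × P → B.V := fun x => τ x.1 (E x.2) - E (x.1 * x.2) + E x.1
  have hzLC : IsLocallyConstant z := by
    exact (((hELC.comp_continuous continuous_snd).apply₂ fun w =>
      (hτLC w).comp_continuous continuous_fst).sub (hELC.comp_continuous continuous_mul)).add
      (hELC.comp_continuous continuous_fst)
  have haux : ∀ a b : (G.trunc k).V, a - (b + a) + b = 0 := fun a b => by abel
  have haux' : ∀ a b : ZMod (p ^ (r + 1)), a - (b + a) + b = 0 := fun a b => by abel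
  -- `z` vanishes mod `p^r` because `e` is a cocycle, so it is `p^r y`. Its last coordinate vanishes
  -- because `C` is a cocycle, so that of `y` is divisible by `p` and can be removed from `y`.
  have hz : ∀ x, ∃ y ∈ B.fil (k - 1), z x = p ^ r • y := fun x => by
    have h1 : liftMap φ (z x) = 0 := by
      have := he x.1 x.2
      simp only [z, map_add, map_sub, hπτ, hE, this]
      exact haux _ _
    have h2 : l k (z x) = 0 := by
      have := hC x.1 x.2
      simp only [z, map_add, map_sub, hlτ, hE, this]
      exact haux' _ _
    obtain ⟨y, hy⟩ := (liftMap_eq_zero_iff φ _).1 h1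
    rw [hy, map_nsmul] at h2
    obtain ⟨t, ht⟩ := exists_eq_mul_prime_of_pow_mul_eq_zero h2
    refine ⟨_, hk'.sub_mem (v := y) (htop ▸ trivial), ?_⟩
    have e1 : l k y • u k = p ^ 1 • (t • u k) := by rw [ht, mul_smul, Nat.cast_smul_eq_nsmul]
    have e2 : p ^ r • p ^ 1 • (t • u k) = 0 := by
      rw [smul_smul, ← pow_add]
      exact nsmul_eq_zero_of_module_zmod _ _
    rw [smul_sub, hy, e1, e2, sub_zero]
  -- transport to the reduction mod `p`
  obtain ⟨ι, hι⟩ := B.exists_mulPow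
  have hιinj : Function.Injective ι := by
    refine (injective_iff_map_eq_zero _).2 fun m hm => ?_
    obtain ⟨w, rfl⟩ := B.toReduce_surjective _ m
    rw [hι] at hm
    exact (B.toReduce_eq_zero_iff _ _).2
      (exists_eq_prime_smul_of_pow_smul_eq_zero h0 hl (htop ▸ trivial) hm)
  -- Mod `p` the twist is trivial on `P`, so `ι` is equivariant from the untwisted reduction.
  have hc1 : ∀ g : P, redUnits hp1 (c g) = 1 := fun g =>
    eq_one_of_isProP (α := (redUnits hp1).comp c) hP.isProP ⟨U', fun g hg => by
      rw [MonoidHom.comp_apply, hU' g hg, map_one]⟩ g.2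
  have hιτ : ∀ (g : P) m, ι ((B.reduce (p ^ 1)).ρ g m) = τ g (ι m) := fun g m => by
    obtain ⟨w, rfl⟩ := B.toReduce_surjective _ m
    have h1 : ZMod.castHom hp1 (ZMod (p ^ 1)) ((c⁻¹ (g : Γ) : (ZMod (p ^ (r + 1)))ˣ)) = 1 := by
      have := congrArg (fun x => ((x⁻¹ : (ZMod (p ^ 1))ˣ) : ZMod (p ^ 1))) (hc1 g)
      simp only [← map_inv, inv_one, Units.val_one] at this
      rwa [MonoidHom.inv_apply, ← map_inv]
    have h2 : τ g (p ^ r • w) = p ^ r • (((c⁻¹ (g : Γ) : (ZMod (p ^ (r + 1)))ˣ) :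
      ZMod (p ^ (r + 1))) • B.ρ g w) := by rw [map_nsmul]; rfl
    rw [hι, h2, ← hι, toReduce_smul _ _ hp1, h1, one_smul, reduce_ρ_toReduce]
  let Y : B.V → (B.reduce (p ^ 1)).V := Function.invFun ι
  let z' : P × P → (B.reduce (p ^ 1)).V := fun x => Y (z x)
  have hz' : ∀ x, ι (z' x) = z x := fun x => by
    obtain ⟨y, -, hy⟩ := hz x
    exact Function.invFun_eq ⟨B.toReduce _ y, by rw [hι, hy]⟩
  have hred := fun i h1 h2 => (hl i h1 h2).reduce hp1
  have hμ1 : ∀ i, 1 ≤ i → i ≤ k → ∀ g : P, redUnits hp1 (μ i g) = 1 := fun i h1 h2 g =>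
    eq_one_of_isProP (α := (redUnits hp1).comp (μ i)) hP.isProP ⟨U, fun g hg => by
      rw [MonoidHom.comp_apply, (hl i h1 h2).char_eq_one (hU g hg), map_one]⟩ g.2
  -- The obstruction lies in step `k - 1` and becomes a coboundary in step `k`, the whole module;
  -- hence no bound on `γ` is kept.
  obtain ⟨γ, hγLC, -, hγ⟩ := exists_cochain_of_wound ((B.reduce (p ^ 1)).ρ.comp P.subtype)
    (fun v => ((B.reduce (p ^ 1)).isLocallyConstant_ρ v).comp_continuous continuous_subtype_val)
    (B.reduce (p ^ 1)).fil (B.reduce (p ^ 1)).mono (by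
      refine (Submodule.eq_bot_iff _).2 fun y hy => ?_
      obtain ⟨v, hv, rfl⟩ := (B.mem_reduce_fil_iff _ _ _).1 hy
      rw [h0, Submodule.mem_bot] at hv
      rw [hv, map_zero]) (fun i g v hv => (B.reduce (p ^ 1)).stable i g hv) (n := k)
    (fun i => IsLine.redForm B hp1 (l i)) (fun i => B.toReduce (p ^ 1) (u i))
    (fun i h1 h2 => (hred i h1 h2).mem) (fun i h1 h2 => (hred i h1 h2).apply_self)
    (fun i h1 h2 => (hred i h1 h2).eq_zero_iff) (fun i h1 h2 g v hv => by
      have := (hred i h1 h2).apply_ρ g v hv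
      rw [MonoidHom.comp_apply, hμ1 i h1 h2 g, Units.val_one, one_mul] at this
      exact this) (fun i h1 h2 =>
      exists_ne_zero_of_not_isSplitVector hP (hred i h1 (by omega)) (hred (i + 1) (by omega) h2)
        fun ⟨v, hv⟩ => hB i h1 h2 (hv.extensionSplits (hred (i + 1) (by omega) h2)))
    (fun a ha ha' ha0 z hz hz' => hD.exists_eq_cup_add (pow_one p) ha ha' ha0 hz hz')
    (i := k - 1) (by omega) (z := z') (hzLC.comp Y) (fun g h m => by
      refine hιinj ?_
      have e1 : ι (((B.reduce (p ^ 1)).ρ.comp P.subtype) g (z' (h, m))) = τ g (z (h, m)) :=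
        (hιτ g _).trans (by rw [hz'])
      rw [map_sub, map_add, map_sub, e1, hz', hz', hz', map_zero]
      simp only [z, map_add, map_sub, mul_assoc, Subgroup.coe_mul, map_mul, Module.End.mul_apply]
      abel) (fun x => by
      obtain ⟨y, hy, hy'⟩ := hz x
      refine (B.mem_reduce_fil_iff _ _ _).2 ⟨y, hy, hιinj ?_⟩
      rw [hι, hz', hy'])
  -- The correction is a multiple of `p^r`, so `e` is still lifted. It may alter the last
  -- coordinate, but `C` has served its purpose.
  refine ⟨fun g => E g - ι (γ g), hELC.sub (hγLC.comp ι), fun g h => ?_, fun g => ?_⟩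
  · have e1 : z (g, h) = τ g (ι (γ h)) - ι (γ (g * h)) + ι (γ g) := by
      rw [← hz', hγ, map_add, map_sub]
      congr 2
      exact hιτ g _
    have e2 : τ g (E h) - E (g * h) + E g = τ g (ι (γ h)) - ι (γ (g * h)) + ι (γ g) := e1
    have e3 : E (g * h) = τ g (E h) + E g - (τ g (ι (γ h)) - ι (γ (g * h)) + ι (γ g)) := by
      rw [← e2]; abel
    change E (g * h) - ι (γ (g * h)) = E g - ι (γ g) + τ g (E h - ι (γ h))
    rw [e3, map_sub]
    abel
  · obtain ⟨w, hw⟩ := B.toReduce_surjective _ (γ g)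
    rw [map_sub, (hE g).1, ← hw, hι, (liftMap_eq_zero_iff φ (p ^ r • w)).2 ⟨w, rfl⟩, sub_zero]

end FilRep

end Lift

lemma comp_redUnits_redUnits {Γ : Type*} [Group Γ] {n m k : ℕ} (h : m ∣ n) (h' : k ∣ m)
    (μ : Γ →* (ZMod n)ˣ) :
    (redUnits h').comp ((redUnits h).comp μ) = (redUnits (h'.trans h)).comp μ :=
  MonoidHom.ext fun g => redUnits_redUnits h h' (μ g)

variable {p : ℕ} [Fact p.Prime] {Γ : Type u} [Group Γ] [TopologicalSpace Γ]

namespace FilRep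

/-! ### Comparing characters and splittings through reduction -/

section Comparison

variable {n m : ℕ}

/-- The image of `u` generates line `i` of `F`: a lift `w` of `u'` has `l w` as the inverse of the
coordinate of that image. So both characters describe one action. -/
lemma IsLine.redUnits_eq {F : FilRep.{u, v} Γ m} {B : FilRep.{u, v} Γ n} {k i : ℕ}
    (φ : Iso (F.trunc k) (B.reduce m)) (hm : m ∣ n) (hi : i ≤ k) {μ : Γ →* (ZMod n)ˣ}
    {l : B.V →ₗ[ZMod n] ZMod n} {u : B.V} (h : B.IsLine i μ l u) {μ' : Γ →* (ZMod m)ˣ}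
    {l' : F.V →ₗ[ZMod m] ZMod m} {u' : F.V} (h' : F.IsLine i μ' l' u') :
    (redUnits hm).comp μ = μ' := by
  have hmem : ∀ j w, w ∈ B.fil j → (liftMap φ w).1 ∈ F.fil j := fun j w hw =>
    (mem_fil_iff_liftMap φ j _).2 ⟨w, hw, rfl⟩
  have hcoe : ∀ a w, ((liftMap φ (a • w)).1 : F.V) = ZMod.castHom hm (ZMod m) a • (liftMap φ w).1 :=
    fun a w => congrArg Subtype.val (liftMap_smul φ hm a w)
  have hzero : ∀ v ∈ F.fil (i - 1), l' v = 0 := fun v hv =>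
    (h'.eq_zero_iff v (F.mono (Nat.sub_le i 1) hv)).2 hv
  have hu := hmem i u h.mem
  obtain ⟨w, hw, hwu⟩ := (mem_fil_iff_liftMap φ i ⟨u', F.mono hi h'.mem⟩).1 h'.mem
  have h1 : ZMod.castHom hm (ZMod m) (l w) * l' (liftMap φ u).1 = 1 := by
    have e1 : l' ((liftMap φ (w - l w • u)).1) = 0 := hzero _ (hmem _ _ (h.sub_mem hw))
    rw [map_sub, hwu] at e1
    change l' (u' - (liftMap φ (l w • u)).1) = 0 at e1
    rw [hcoe, map_sub, h'.apply_self, map_smul, sub_eq_zero] at e1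
    exact e1.symm
  refine MonoidHom.ext fun g => Units.ext ?_
  have h2 : B.ρ g u - (μ g : ZMod n) • u ∈ B.fil (i - 1) := by
    have := h.sub_mem (B.stable i g h.mem)
    rwa [h.apply_ρ g u h.mem, h.apply_self, mul_one] at this
  have e1 : l' ((liftMap φ (B.ρ g u - (μ g : ZMod n) • u)).1) = 0 := hzero _ (hmem _ _ h2)
  rw [map_sub, liftMap_ρ] at e1
  change l' (F.ρ g (liftMap φ u).1 - (liftMap φ ((μ g : ZMod n) • u)).1) = 0 at e1
  rw [hcoe, map_sub, h'.apply_ρ g _ hu, map_smul, smul_eq_mul, ← sub_mul] at e1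
  have e2 := congrArg (ZMod.castHom hm (ZMod m) (l w) * ·) e1
  simp only [mul_zero] at e2
  rw [mul_left_comm, h1, mul_one, sub_eq_zero] at e2
  exact e2.symm

/-- With this, a splitting of the lifted flag mod `p` would give one for the original flag.
Injectivity of the induced map plays no role, only surjectivity on each step. -/
lemma IsSplitVector.map_reduce {E : FilRep.{u, v} Γ n} {F : FilRep.{u, v} Γ m} (q : E.V →+ F.V)
    (hρ : ∀ g x, q (E.ρ g x) = F.ρ g (q x))
    (hfil : ∀ i y, y ∈ F.fil i ↔ ∃ x ∈ E.fil i, q x = y) {k i : ℕ} {v : (E.reduce k).V}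
    (hv : (E.reduce k).IsSplitVector i v) : ∃ v', (F.reduce k).IsSplitVector i v' := by
  let Q : (E.reduce k).V →ₗ[ZMod k] (F.reduce k).V := q.toIntLinearMap.baseChange (ZMod k)
  have hQ : ∀ x, Q (E.toReduce k x) = F.toReduce k (q x) := fun x => rfl
  have hQfil : ∀ i y, y ∈ (E.reduce k).fil i → Q y ∈ (F.reduce k).fil i := fun i y hy => by
    obtain ⟨x, hx, rfl⟩ := (E.mem_reduce_fil_iff k i y).1 hy
    exact (F.mem_reduce_fil_iff k i _).2 ⟨q x, (hfil i _).2 ⟨x, hx, rfl⟩, (hQ x).symm⟩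
  have hQρ : ∀ g y, Q ((E.reduce k).ρ g y) = (F.reduce k).ρ g (Q y) := fun g y => by
    obtain ⟨x, rfl⟩ := E.toReduce_surjective k y
    rw [reduce_ρ_toReduce, hQ, hQ, hρ, reduce_ρ_toReduce]
  obtain ⟨h1, h2, h3⟩ := hv
  refine ⟨Q v, hQfil _ _ h1, fun w hw => ?_, fun g => ?_⟩
  · obtain ⟨y, hy, rfl⟩ := (F.mem_reduce_fil_iff k _ w).1 hw
    obtain ⟨x, hx, rfl⟩ := (hfil _ y).1 hy
    obtain ⟨a, ha⟩ := h2 _ ((E.mem_reduce_fil_iff k _ _).2 ⟨x, hx, rfl⟩)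
    refine ⟨a, ?_⟩
    rw [← hQ, ← map_smul, ← map_sub]
    exact hQfil _ _ ha
  · obtain ⟨a, ha⟩ := h3 g
    refine ⟨a, ?_⟩
    rw [← hQρ, ← map_smul, ← map_sub]
    exact hQfil _ _ ha

end Comparison

end FilRep

section Characters

variable {χ : Γ →ₜ* ℤ_[p]ˣ} {s : ℕ}

lemma exists_openNormalSubgroup_kummerChar [IsTopologicalGroup Γ] [CompactSpace Γ]
    [TotallyDisconnectedSpace Γ] (N : ℤ) (i : ℕ) {κ : Γ →* (ZMod (p ^ 1))ˣ}
    (hκ : ∃ U : OpenNormalSubgroup Γ, ∀ g ∈ U, κ g = 1) :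
    ∃ U : OpenNormalSubgroup Γ, ∀ g ∈ U, kummerChar χ s N i κ g = 1 := by
  obtain ⟨U, hU⟩ := hκ
  obtain ⟨V, hV⟩ := exists_openNormalSubgroup_charMod χ s
  obtain ⟨W, hW⟩ := exists_openNormalSubgroup_charMod χ 1
  refine ⟨U ⊓ V ⊓ W, fun g hg => ?_⟩
  change charMod χ s g ^ (N - i) * teichmuller p s (charMod χ 1 g ^ (i : ℤ) * κ g) = 1
  rw [hU g hg.1.1, hV g hg.1.2, hW g hg.2]
  simp

/-- The Teichmüller part of the character is trivial on pro-`p` subgroups. -/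
lemma kummerChar_eq_of_isProP [IsTopologicalGroup Γ] [CompactSpace Γ] [TotallyDisconnectedSpace Γ]
    {P : Subgroup Γ} (hP : IsProP p P) (N : ℤ) (i : ℕ) {κ : Γ →* (ZMod (p ^ 1))ˣ}
    (hκ : ∃ U : OpenNormalSubgroup Γ, ∀ g ∈ U, κ g = 1) {g : Γ} (hg : g ∈ P) :
    kummerChar χ s N i κ g = charMod χ s g ^ (N - i) := by
  obtain ⟨U, hU⟩ := hκ
  obtain ⟨W, hW⟩ := exists_openNormalSubgroup_charMod χ 1
  have h1 : charMod χ 1 g ^ (i : ℤ) * κ g = 1 :=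
    eq_one_of_isProP (α := charMod χ 1 ^ (i : ℤ) * κ) hP ⟨U ⊓ W, fun g hg => by
      change charMod χ 1 g ^ (i : ℤ) * κ g = 1
      rw [hU g hg.1, hW g hg.2]
      simp⟩ hg
  change charMod χ s g ^ (N - i) * teichmuller p s (charMod χ 1 g ^ (i : ℤ) * κ g) = _
  rw [h1, map_one, mul_one]

/-- The integer `N` in the Kummer condition for a flag may be replaced by one which gives the same
character in rank one. -/
lemma kummerChar_congr {N N' : ℤ} {i : ℕ} {κ : Γ →* (ZMod (p ^ 1))ˣ}
    (h : kummerChar χ s N i κ = kummerChar χ s N' i κ) (j : ℕ) (κ' : Γ →* (ZMod (p ^ 1))ˣ) :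
    kummerChar χ s N j κ' = kummerChar χ s N' j κ' := by
  have h1 : charMod χ s ^ (N - i) = charMod χ s ^ (N' - i) := mul_right_cancel h
  have h2 : charMod χ s ^ (N - j) = charMod χ s ^ (N' - j) := by
    refine MonoidHom.ext fun g => ?_
    have h2 : charMod χ s g ^ (N - i) = charMod χ s g ^ (N' - i) := DFunLike.congr_fun h1 g
    change charMod χ s g ^ (N - j) = charMod χ s g ^ (N' - j)
    rw [show N - (j : ℤ) = (N - i) + (i - j) by ring,
      show N' - (j : ℤ) = (N' - i) + (i - j) by ring,
      zpow_add, zpow_add, h2]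
  rw [kummerChar, kummerChar, h2]

end Characters

/-- A wound Kummer flag and a lift of its truncation satisfy the Kummer condition with a common
integer `N`. -/
lemma exists_common_kummer {χ : Γ →ₜ* ℤ_[p]ˣ} {d r : ℕ} (hr : 1 ≤ r)
    {F : FilRep.{u, v} Γ (p ^ r)} (hF : IsWoundKummer χ F d)
    {B : FilRep.{u, v} Γ (p ^ (r + 1))} (hB : IsWoundKummer χ B (d - 1))
    (φ : FilRep.Iso (F.trunc (d - 1)) (B.reduce (p ^ r))) :
    ∃ (N : ℤ) (μ : ℕ → Γ →* (ZMod (p ^ r))ˣ) (ν : ℕ → Γ →* (ZMod (p ^ (r + 1)))ˣ),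
      (∀ i, 1 ≤ i → i ≤ d → (∃ l u, F.IsLine i (μ i) l u) ∧
        μ i = kummerChar χ r N i ((redUnits (pow_dvd_pow p hr)).comp (μ i))) ∧
      ∀ i, 1 ≤ i → i ≤ d - 1 → (∃ l u, B.IsLine i (ν i) l u) ∧
        ν i = kummerChar χ (r + 1) N i
          ((redUnits (pow_dvd_pow p (Nat.le_add_left 1 r))).comp (ν i)) := by
  classical
  obtain ⟨N, hN⟩ := hF.kummer
  obtain ⟨N', hN'⟩ := hB.kummer
  have h1 := fun i hi hid => exists_isLine_of_kummer (i := i) hr hF.isCompleteFlag.top hN hi hid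
  have h2 := fun i hi hid => exists_isLine_of_kummer (i := i) (Nat.le_add_left 1 r)
    hB.isCompleteFlag.top hN' hi hid
  choose! μ l u hl hμ using h1
  choose! ν l' u' hl' hν using h2
  -- For `d ≤ 1` nothing is asked of `B`, and the integer of `F` is taken. Otherwise that of `B`
  -- must be kept, since it matters mod `p^(r+1)`; comparing the first lines shows that it also
  -- serves `F` mod `p^r`.
  by_cases hd : d ≤ 1
  · exact ⟨N, μ, ν, fun i hi hid => ⟨⟨_, _, hl i hi hid⟩, hμ i hi hid⟩,
      fun i hi hid => absurd hid (by omega)⟩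
  · refine ⟨N', μ, ν, fun i hi hid => ⟨⟨_, _, hl i hi hid⟩, ?_⟩,
      fun i hi hid => ⟨⟨_, _, hl' i hi hid⟩, hν i hi hid⟩⟩
    have e1 : (redUnits (pow_dvd_pow p r.le_succ)).comp (ν 1) = μ 1 :=
      (hl' 1 le_rfl (by omega)).redUnits_eq φ _ (by omega) (hl 1 le_rfl (by omega))
    have e2 := hν 1 le_rfl (by omega)
    have e3 := congrArg (redUnits (pow_dvd_pow p r.le_succ)).comp e2
    rw [redUnits_kummerChar χ r.le_succ, e1,
      ← comp_redUnits_redUnits (pow_dvd_pow p r.le_succ) (pow_dvd_pow p hr), e1] at e3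
    exact (hμ i hi hid).trans (kummerChar_congr ((hμ 1 le_rfl (by omega)).symm.trans e3) i _)

/-! ### Lifting over `Γ` and construction of the lifted flag -/

variable [IsTopologicalGroup Γ] [CompactSpace Γ] [TotallyDisconnectedSpace Γ]

/-- Cocycles with values in a twist of a wound flag lift, provided that the twisted action on the
last graded piece is through `χ`, over pro-`p` subgroups. -/
theorem FilRep.exists_lift_of_isManageable {χ : Γ →ₜ* ℤ_[p]ˣ} (hΓ : IsManageable χ) {r : ℕ}
    (hr : 1 ≤ r) {B : FilRep.{u, v} Γ (p ^ (r + 1))} {k : ℕ} {μ : ℕ → Γ →* (ZMod (p ^ (r + 1)))ˣ}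
    {l : ℕ → B.V →ₗ[ZMod (p ^ (r + 1))] ZMod (p ^ (r + 1))} {u : ℕ → B.V}
    (h0 : B.fil 0 = ⊥) (hk : 1 ≤ k) (htop : B.fil k = ⊤)
    (hl : ∀ i, 1 ≤ i → i ≤ k → B.IsLine i (μ i) (l i) (u i)) (hB : IsWound B k)
    {c : Γ →* (ZMod (p ^ (r + 1)))ˣ} (hc : ∃ U : OpenNormalSubgroup Γ, ∀ g ∈ U, c g = 1)
    (hcχ : ∀ P : Subgroup Γ, IsProP p P → ∀ g ∈ P, (μ k * c⁻¹) g = charMod χ (r + 1) g)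
    {G : FilRep.{u, v} Γ (p ^ r)} (φ : Iso (G.trunc k) (B.reduce (p ^ r)))
    {e : Γ → (G.trunc k).V}
    (he : IsCocycle (twist ((redUnits (pow_dvd_pow p r.le_succ)).comp c)⁻¹ (G.trunc k).ρ) e)
    (he' : ∃ U : OpenNormalSubgroup Γ, ∀ g ∈ U, e g = 0) :
    ∃ f : Γ → B.V, IsCocycle (twist c⁻¹ B.ρ) f ∧ (∃ U : OpenNormalSubgroup Γ, ∀ g ∈ U, f g = 0) ∧
      ∀ g, liftMap φ (f g) = e g := by
  have hpr : p ^ r ∣ p ^ (r + 1) := pow_dvd_pow p r.le_succ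
  have hk' := (hl k hk le_rfl).reduce hpr
  -- The two Sylow subgroups may differ. The lift found over `P'` is therefore first descended to
  -- `Γ`, and then restricted to `P`.
  obtain ⟨P, hP, hD⟩ := hΓ.isPDemushkin
  obtain ⟨P', hP', h90⟩ := hΓ.wH90
  have htop' : ∀ y, y ∈ (B.reduce (p ^ r)).fil k := fun y => by
    obtain ⟨x, rfl⟩ := B.toReduce_surjective _ y
    exact (B.mem_reduce_fil_iff _ _ _).2 ⟨x, htop ▸ trivial, rfl⟩
  -- the image in the last graded piece
  let π : (G.trunc k).V →ₗ[ZMod (p ^ r)] ZMod (p ^ r) :=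
    IsLine.redForm B hpr (l k) ∘ₗ φ.equiv.toLinearMap
  have hπ : ∀ g v, π (twist ((redUnits hpr).comp c)⁻¹ (G.trunc k).ρ g v) =
      ofCharacter ((redUnits hpr).comp (μ k * c⁻¹)) g (π v) := fun g v => by
    have e1 : π ((G.trunc k).ρ g v) = ((redUnits hpr).comp (μ k) g : ZMod (p ^ r)) * π v :=
      (congrArg _ (φ.equivariant g v)).trans (hk'.apply_ρ g _ (htop' _))
    have e2 : (((redUnits hpr).comp (μ k * c⁻¹) g : (ZMod (p ^ r))ˣ) : ZMod (p ^ r)) =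
        ((((redUnits hpr).comp c)⁻¹ g : (ZMod (p ^ r))ˣ) : ZMod (p ^ r)) *
          (redUnits hpr).comp (μ k) g := by
      rw [← Units.val_mul]
      congr 1
      simp only [MonoidHom.comp_apply, MonoidHom.mul_apply, MonoidHom.inv_apply, map_mul, map_inv]
      exact mul_comm _ _
    rw [twist_apply, map_smul, e1, ofCharacter_apply, e2, smul_eq_mul, mul_assoc]
  have heX := he.map π.toAddMonoidHom hπ
  have heLC := isLocallyConstant_of_isCocycle he _ he'.choose_spec
  have hX : ∀ (g : P') (a : ZMod (p ^ r)), ofCharacter ((redUnits hpr).comp (μ k * c⁻¹)) g a =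
      tateOne χ r g a := fun g a => by
    rw [tateOne, ofCharacter_apply, ofCharacter_apply, MonoidHom.comp_apply,
      hcχ P' hP'.isProP g g.2,
      redUnits_charMod χ r.le_succ]
  obtain ⟨C', hC', hC'', hC'e⟩ := exists_lift_of_wH90 h90 hr
    (c := fun g : P' => π (e g)) ((heLC.comp_continuous continuous_subtype_val).comp π)
    ((heX.comp P'.subtype).congr hX)
  obtain ⟨U, hU⟩ := B.continuous
  obtain ⟨U', hU'⟩ := hc
  obtain ⟨C, hC, ⟨V, hV⟩, hCe⟩ := exists_lift_of_sylow_of_surjective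
    (ρ := ofCharacter (μ k * c⁻¹)) (ρ' := ofCharacter ((redUnits hpr).comp (μ k * c⁻¹)))
    (s := r) hP'
    (nsmul_eq_zero_of_module_zmod (p ^ r)) ⟨U ⊓ U', fun g hg => by
      ext
      simp [(hl k hk le_rfl).char_eq_one (hU g hg.1), hU' g hg.2]⟩ (redSucc p r).toAddMonoidHom
    (fun g a => map_mul (redSucc p r) _ _) (ZMod.castHom_surjective hpr) heX
    (he'.imp fun U hU g hg => by
      rw [Function.comp_apply, hU g hg, map_zero])
    (hC''.congr fun g a => by
      change tateOne χ (r + 1) g a = ofCharacter (μ k * c⁻¹) g a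
      rw [tateOne, ofCharacter_apply, ofCharacter_apply, hcχ P' hP'.isProP g g.2]) hC' hC'e
  obtain ⟨f, hfLC, hf, hfe⟩ := exists_lift_of_isDemushkin hP hD h0 hk htop hl hB ⟨U', hU'⟩ φ
    (e := fun g => e g) (heLC.comp_continuous continuous_subtype_val) (he.comp P.subtype)
    (C := fun g => C g)
    ((isLocallyConstant_of_isCocycle hC V hV).comp_continuous continuous_subtype_val)
    (hC.comp P.subtype) (fun g => hCe g)
  exact exists_lift_of_sylow_of_surjective hP (nsmul_eq_zero_of_module_zmod (p ^ r))
    ⟨U ⊓ U', fun g hg => by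
      ext
      simp [hU g hg.1, hU' g hg.2]⟩ (liftMap φ) (fun g w => by
      rw [twist_apply, liftMap_smul φ hpr, liftMap_ρ, twist_apply]
      congr 1) (liftMap_surjective φ) he he' hf hfLC hfe

open FilRep in
/-- Step-by-step liftability of wound Kummer flags. -/
theorem exists_lift_of_isWoundKummer (χ : Γ →ₜ* ℤ_[p]ˣ) (hΓ : IsManageable χ)
    (d r : ℕ) (hd : 1 ≤ d) (hr : 1 ≤ r)
    (F : FilRep.{u, v} Γ (p ^ r)) (hF : IsWoundKummer χ F d)
    (B : FilRep.{u, v} Γ (p ^ (r + 1)))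
    (hB : IsWoundKummer χ B (d - 1))
    (φ : FilRep.Iso (F.trunc (d - 1)) (B.reduce (p ^ r))) :
    ∃ E : FilRep.{u, v} Γ (p ^ (r + 1)),
      IsWoundKummer χ E d ∧
      ∃ (ψ : FilRep.Iso (E.reduce (p ^ r)) F)
        (θ : FilRep.Iso (E.trunc (d - 1)) B),
        θ.reduceMap (p ^ r) =
          φ.equiv.toLinearMap ∘ₗ ψ.truncMap (d - 1) ∘ₗ E.reduceTrunc (d - 1) (p ^ r) := by
  have hp1 : p ^ 1 ∣ p ^ r := pow_dvd_pow p hr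
  have hp1' : p ^ 1 ∣ p ^ (r + 1) := pow_dvd_pow p (Nat.le_add_left 1 r)
  have hpr : p ^ r ∣ p ^ (r + 1) := pow_dvd_pow p r.le_succ
  obtain ⟨N, μ, ν, hμ, hν⟩ := exists_common_kummer hr hF hB φ
  have hBtop := hB.isCompleteFlag.top
  obtain ⟨⟨l, v, hl⟩, hμd⟩ := hμ d hd le_rfl
  obtain ⟨UF, hUF⟩ := F.continuous
  obtain ⟨UB, hUB⟩ := B.continuous
  -- the character on the last graded piece of the lift
  set κ := (redUnits hp1).comp (μ d) with hκ
  have hκ1 : ∃ U : OpenNormalSubgroup Γ, ∀ g ∈ U, κ g = 1 := ⟨UF, fun g hg => by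
    rw [hκ, MonoidHom.comp_apply, hl.char_eq_one (hUF g hg), map_one]⟩
  obtain ⟨c, hc⟩ : ∃ c, c = kummerChar χ (r + 1) N d κ := ⟨_, rfl⟩
  have hcr : (redUnits hpr).comp c = μ d := by
    rw [hc, redUnits_kummerChar χ r.le_succ, ← hμd]
  have hc1 : c = kummerChar χ (r + 1) N d ((redUnits hp1').comp c) := by
    rw [← comp_redUnits_redUnits hpr hp1, hcr, ← hc]
  obtain ⟨Uc, hUc⟩ := exists_openNormalSubgroup_kummerChar (χ := χ) (s := r + 1) N d hκ1
  rw [← hc] at hUc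
  -- the cocycle of the extension
  have hmem : ∀ g, twist (μ d)⁻¹ F.ρ g v - v ∈ F.fil (d - 1) := fun g => by
    have := hl.sub_mem (F.stable d g hl.mem)
    rw [hl.apply_ρ g v hl.mem, hl.apply_self, mul_one] at this
    have := Submodule.smul_mem _ (((μ d)⁻¹ g : (ZMod (p ^ r))ˣ) : ZMod (p ^ r)) this
    rwa [smul_sub, smul_smul, MonoidHom.inv_apply, Units.inv_mul, one_smul] at this
  -- This is the coboundary of `v` inside `V_d`; as `v` is not in `V_{d-1}`, it need not be a
  -- coboundary there.
  let e : Γ → (F.trunc (d - 1)).V := fun g => ⟨_, hmem g⟩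
  have he : IsCocycle (twist ((redUnits hpr).comp c)⁻¹ (F.trunc (d - 1)).ρ) e := fun g h => by
    rw [hcr]
    exact Subtype.ext (IsCocycle.coboundary (twist (μ d)⁻¹ F.ρ) v g h)
  have he' : ∃ U : OpenNormalSubgroup Γ, ∀ g ∈ U, e g = 0 := ⟨UF, fun g hg => Subtype.ext (by
    change twist (μ d)⁻¹ F.ρ g v - v = 0
    simp [hl.char_eq_one (hUF g hg), hUF g hg])⟩
  obtain ⟨f, hf, ⟨Uf, hUf⟩, hfe⟩ : ∃ f : Γ → B.V, IsCocycle (twist c⁻¹ B.ρ) f ∧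
      (∃ U : OpenNormalSubgroup Γ, ∀ g ∈ U, f g = 0) ∧ ∀ g, liftMap φ (f g) = e g := by
    -- In rank one the cocycle takes its values in `V_0 = 0`, and there is no graded piece to which
    -- weak Hilbert 90 could apply.
    by_cases hd1 : d = 1
    · refine ⟨0, fun g h => by simp, ⟨UF, fun g hg => rfl⟩, fun g => ?_⟩
      have h0 : twist (μ d)⁻¹ F.ρ g v - v ∈ F.fil 0 := by simpa [hd1] using hmem g
      rw [hF.isCompleteFlag.zero, Submodule.mem_bot] at h0
      exact (map_zero (liftMap φ)).trans (Subtype.ext h0.symm)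
    · choose! l' u' hl' using fun i hi hid => (hν i hi hid).1
      refine exists_lift_of_isManageable hΓ hr hB.isCompleteFlag.zero (by omega) hBtop hl'
        hB.isWound ⟨Uc, hUc⟩ (fun P hP g hg => ?_) φ he he'
      have h1 := hν (d - 1) (by omega) le_rfl
      rw [MonoidHom.mul_apply, MonoidHom.inv_apply, h1.2, hc, kummerChar_eq_of_isProP hP N d hκ1 hg,
        kummerChar_eq_of_isProP hP N (d - 1) ⟨UB, fun g hg => by
          rw [MonoidHom.comp_apply, (hl' _ (by omega) le_rfl).char_eq_one (hUB g hg), map_one]⟩ hg,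
        ← zpow_neg, ← zpow_add]
      -- The exponents are `(N - (d - 1)) - (N - d) = 1`.
      convert zpow_one _
      push_cast [Nat.cast_sub hd]
      ring
  have hU : ∃ U : OpenNormalSubgroup Γ, ∀ g ∈ U, c g = 1 ∧ f g = 0 :=
    ⟨Uc ⊓ Uf, fun g hg => ⟨hUc g hg.1, hUf g hg.2⟩⟩
  let E := extension B c hf hU d
  have hE : ∀ i, 1 ≤ i → i ≤ d → ∃ ρ l u, E.IsLine i ρ l u ∧
      ρ = kummerChar χ (r + 1) N i ((redUnits hp1').comp ρ) := fun i hi hid => by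
    rcases hid.lt_or_eq with hid | rfl
    · obtain ⟨⟨l, u, hl⟩, h⟩ := hν i hi (by omega)
      exact ⟨_, _, _, hl.extension hf hU hid, h⟩
    · exact ⟨_, _, _, extension_isLine hf hU hi hBtop, hc1⟩
  -- the reduction map
  let π : B.V →+ F.V := AddMonoidHom.comp
    (show (F.trunc (d - 1)).V →+ F.V from (F.fil (d - 1)).subtype.toAddMonoidHom) (liftMap φ)
  have hπρ : ∀ g w, π (B.ρ g w) = F.ρ g (π w) := fun g w => congrArg Subtype.val (liftMap_ρ φ g w)
  have hπsmul : ∀ a w, π (a • w) = ZMod.castHom hpr (ZMod (p ^ r)) a • π w := fun a w =>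
    congrArg Subtype.val (liftMap_smul φ hpr a w)
  have hπf : ∀ g, π (f g) = twist (μ d)⁻¹ F.ρ g v - v := fun g => congrArg Subtype.val (hfe g)
  have hπfil : ∀ i, i < d → ∀ y, y ∈ F.fil i ↔ ∃ w ∈ B.fil i, π w = y := fun i hi y => by
    constructor
    · intro hy
      obtain ⟨w, hw, hwy⟩ := (mem_fil_iff_liftMap φ i ⟨y, F.mono (by omega) hy⟩).1 hy
      exact ⟨w, hw, congrArg Subtype.val hwy⟩
    · rintro ⟨w, hw, rfl⟩
      exact (mem_fil_iff_liftMap φ i _).2 ⟨w, hw, rfl⟩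
  have hlπ : ∀ w, l (π w) = 0 := fun w =>
    (hl.eq_zero_iff _ (F.mono (Nat.sub_le d 1) (liftMap φ w).2)).2 (liftMap φ w).2
  -- The new generator goes to `v`; equivariance holds because `f` lifts the cocycle of `v`.
  let q : E.V →+ F.V := AddMonoidHom.coprod π
    ((LinearMap.toSpanSingleton (ZMod (p ^ r)) F.V v).toAddMonoidHom.comp
      (ZMod.castHom hpr (ZMod (p ^ r))).toAddMonoidHom)
  have hq : ∀ x, q x = π x.1 + ZMod.castHom hpr (ZMod (p ^ r)) x.2 • v := fun x => rfl
  have hqρ : ∀ g x, q (E.ρ g x) = F.ρ g (q x) := fun g x => by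
    have h1 : ZMod.castHom hpr (ZMod (p ^ r)) (c g) = μ d g := congrArg Units.val
      (DFunLike.congr_fun hcr g)
    have h2 : (μ d g : ZMod (p ^ r)) • π (f g) = F.ρ g v - (μ d g : ZMod (p ^ r)) • v := by
      rw [hπf, twist_apply, smul_sub, smul_smul, MonoidHom.inv_apply, Units.mul_inv, one_smul]
    change π (B.ρ g x.1 + x.2 • (c g : ZMod (p ^ (r + 1))) • f g) +
      ZMod.castHom hpr (ZMod (p ^ r)) (c g * x.2) • v =
      F.ρ g (π x.1 + ZMod.castHom hpr (ZMod (p ^ r)) x.2 • v)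
    rw [map_add, hπρ, hπsmul, hπsmul, h1, h2, map_mul, h1, map_add, map_smul, smul_sub, smul_smul,
      mul_comm (μ d g : ZMod (p ^ r))]
    abel
  have hqfil : ∀ i y, y ∈ F.fil i ↔ ∃ x ∈ E.fil i, q x = y := fun i y => by
    by_cases hi : i < d
    · rw [hπfil i hi]
      constructor
      · rintro ⟨w, hw, rfl⟩
        exact ⟨(w, 0), (mem_extension_fil hf hU hi _).2 ⟨hw, rfl⟩, (hq (w, 0)).trans (by
          rw [map_zero, zero_smul, add_zero])⟩
      · rintro ⟨x, hx, rfl⟩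
        obtain ⟨h1, h2⟩ := (mem_extension_fil hf hU hi _).1 hx
        exact ⟨x.1, h1, by rw [hq, h2, map_zero, zero_smul, add_zero]⟩
    · have htop := F.mono (not_lt.1 hi)
      rw [hF.isCompleteFlag.top, top_le_iff] at htop
      refine ⟨fun _ => ?_, fun _ => htop ▸ trivial⟩
      have h1 : y ∈ F.fil d := hF.isCompleteFlag.top ▸ trivial
      obtain ⟨w, -, hw⟩ := (hπfil (d - 1) (by omega) _).1 (hl.sub_mem h1)
      obtain ⟨t, ht⟩ := ZMod.castHom_surjective hpr (l y)
      refine ⟨(w, t), (extension_fil_eq_top hf hU (not_lt.1 hi)) ▸ trivial, (hq (w, t)).trans ?_⟩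
      rw [hw, ht, sub_add_cancel]
  have hqker : ∀ x, q x = 0 → ∃ y, x = p ^ r • y := fun x hx => by
    rw [hq] at hx
    have h1 : ZMod.castHom hpr (ZMod (p ^ r)) x.2 = 0 := by
      have := congrArg l hx
      rwa [map_add, hlπ, zero_add, map_smul, hl.apply_self, smul_eq_mul, mul_one, map_zero] at this
    rw [h1, zero_smul, add_zero] at hx
    obtain ⟨t, ht⟩ := IsLine.exists_eq_mul_of_castHom_eq_zero hpr h1
    obtain ⟨y, hy⟩ := (liftMap_eq_zero_iff φ x.1).1 (Subtype.ext hx)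
    exact ⟨(y, t), Prod.ext hy (ht.trans (nsmul_eq_mul _ _).symm)⟩
  have hqsurj : Function.Surjective q := fun y => by
    obtain ⟨x, -, hx⟩ := (hqfil d y).1 (hF.isCompleteFlag.top ▸ trivial)
    exact ⟨x, hx⟩
  have : Nontrivial (ZMod (p ^ (r + 1))) :=
    ZMod.nontrivial_iff.2 (Nat.one_lt_pow r.succ_ne_zero (Fact.out : p.Prime).one_lt).ne'
  refine ⟨E, ⟨extension_isCompleteFlag hf hU hd hB.isCompleteFlag, fun i hi hid hs => ?_,
    N, fun i hi hid => ?_⟩, isoReduce q hqsurj hqker hqρ hqfil, extensionTrunc hf hU hd hBtop, ?_⟩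
  -- A splitting of `E` mod `p` is carried along `q` to `F`, which is wound.
  · obtain ⟨ρ, l, u, hl, -⟩ := hE (i + 1) (by omega) hid
    obtain ⟨w, hw⟩ := exists_isSplitVector_of_extensionSplits (hl.reduce hp1') hs
    obtain ⟨w', hw'⟩ := hw.map_reduce q hqρ hqfil
    obtain ⟨⟨l, u, hl⟩, -⟩ := hμ (i + 1) (by omega) hid
    exact hF.isWound i hi hid (hw'.extensionSplits (hl.reduce hp1))
  · obtain ⟨ρ, l, u, hl, hρ⟩ := hE i hi hid
    exact hl.kummer (Nat.le_add_left 1 r) hρ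
  · refine LinearMap.ext fun y => ?_
    obtain ⟨x, rfl⟩ := (E.trunc (d - 1)).toReduce_surjective (p ^ r) y
    change B.toReduce (p ^ r) x.1.1 = φ.equiv _
    rw [← equiv_liftMap φ]
    refine congrArg φ.equiv (Subtype.ext ?_)
    have h2 : x.1.2 = 0 := ((mem_extension_fil hf hU (by omega) _).1 x.2).2
    refine Eq.trans ?_ (isoReduce_toReduce q hqsurj hqker hqρ hqfil x.1).symm
    rw [hq, h2, map_zero, zero_smul, add_zero]
    rfl

end WoundKummer

end

theorem mainTheorem3 {p : ℕ} [Fact p.Prime]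
    {Γ : Type u} [Group Γ] [TopologicalSpace Γ] [IsTopologicalGroup Γ] [CompactSpace Γ]
    [TotallyDisconnectedSpace Γ]
    (χ : Γ →ₜ* ℤ_[p]ˣ) (hΓ : WoundKummer.IsManageable χ)
    (d r : ℕ) (hd : 1 ≤ d) (hr : 1 ≤ r)
    (F : WoundKummer.FilRep.{u, v} Γ (p ^ r)) (hF : WoundKummer.IsWoundKummer χ F d)
    (B : WoundKummer.FilRep.{u, v} Γ (p ^ (r + 1)))
    (hB : WoundKummer.IsWoundKummer χ B (d - 1))
    (φ : WoundKummer.FilRep.Iso (F.trunc (d - 1)) (B.reduce (p ^ r))) :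
    ∃ E : WoundKummer.FilRep.{u, v} Γ (p ^ (r + 1)),
      WoundKummer.IsWoundKummer χ E d ∧
      ∃ (ψ : WoundKummer.FilRep.Iso (E.reduce (p ^ r)) F)
        (θ : WoundKummer.FilRep.Iso (E.trunc (d - 1)) B),
        θ.reduceMap (p ^ r) =
          φ.equiv.toLinearMap ∘ₗ ψ.truncMap (d - 1) ∘ₗ E.reduceTrunc (d - 1) (p ^ r) :=
  WoundKummer.exists_lift_of_isWoundKummer χ hΓ d r hd hr F hF B hB φ
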